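/- Let $c:\mathbb R\to(0,\infty)$ be a non-constant $C^2$ function (the doping profile), and consider the Cauchy problem for the one-dimensional repulsive pressureless Euler--Poisson system $$V_t+VV_x=-E,\qquad E_t+VE_x=c(x)V\qquad(n=c(x)-E_x),\qquad (V,E)|_{t=0}=(V_0,E_0)\in C^2(\mathbb R),$$ whose equilibrium is $V=E=0$. A classical solution is a $C^1$ solution, and its characteristic from $x_0$ is the curve $\dot x=V(t,x)$, $x(0)=x_0$. Then every small smooth perturbation of the equilibrium that is present at a point where $c$ varies blows up in finite time. Precisely: there are points $x_0$ with $c'(x_0)\neq0$, and for each such $x_0$ there is $\varepsilon>0$, depending only on $c$ and $x_0$, such that for all $V_0,E_0\in C^2(\mathbb R)$ with $$0<\|(V_0(x_0),E_0(x_0))\|<\varepsilon$$ there is $T\in(0,\infty)$ with the following properties. 1. There is a classical solution in a (relatively open) neighbourhood in $\{t\ge0\}$ of the characteristic starting from $x_0$, $0\le t<T$, and for every such solution $|V_x|+|E_x|\to\infty$ along this characteristic as $t\to T^-$. 2. There is no classical solution on $[0,T')\times\mathbb R$ for any $T'>T$. -/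

import Mathlib

open Set Filter Topology

namespace EulerPoisson

/-- `(V, E)` is a classical (`C¹`) solution of the one-dimensional repulsive pressureless
Euler-Poisson system with doping profile `c`
`V_t + V V_x = -E`, `E_t + V E_x = c(x) V` (the density being `n = c - E_x`),
with Cauchy data `V(0, x) = V₀(x)`, `E(0, x) = E₀(x)`, on the part `t ≥ 0` of the set `U` of
points `(t, x)` of the space-time plane. It is meant for open `U`; time derivatives at `t = 0`
are one-sided. -/
structure IsClassicalSolution (c V₀ E₀ : ℝ → ℝ) (U : Set (ℝ × ℝ)) (V E : ℝ → ℝ → ℝ) : Prop where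
  contDiffOn_V : ContDiffOn ℝ 1 (Function.uncurry V) (U ∩ {p | 0 ≤ p.1})
  contDiffOn_E : ContDiffOn ℝ 1 (Function.uncurry E) (U ∩ {p | 0 ≤ p.1})
  eq_V : ∀ t x, 0 ≤ t → (t, x) ∈ U →
    derivWithin (fun s => V s x) (Ici 0) t + V t x * deriv (V t) x = -E t x
  eq_E : ∀ t x, 0 ≤ t → (t, x) ∈ U →
    derivWithin (fun s => E s x) (Ici 0) t + V t x * deriv (E t) x = c x * V t x
  initial_V : ∀ x, (0, x) ∈ U → V 0 x = V₀ x
  initial_E : ∀ x, (0, x) ∈ U → E 0 x = E₀ x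

/-- `x` is, on the time interval `[0, T)`, the characteristic of the velocity field `V` that starts
from `x₀`, and it stays inside the set `U` of the space-time plane. -/
structure IsCharacteristic (V : ℝ → ℝ → ℝ) (U : Set (ℝ × ℝ)) (x₀ T : ℝ) (x : ℝ → ℝ) : Prop where
  start : x 0 = x₀
  mem : ∀ t ∈ Ico 0 T, (t, x t) ∈ U
  deriv_eq : ∀ t ∈ Ico 0 T, HasDerivWithinAt x (V t (x t)) (Ici 0) t

/-- The solution of the Cauchy problem blows up at the time `T` along the characteristic starting
from `x₀`: a classical solution exists in a neighbourhood of this characteristic for `0 ≤ t < T`,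
and for every such solution the first derivatives become infinite along the characteristic as
`t → T`. -/
def BlowsUpAlongCharacteristicAt (c V₀ E₀ : ℝ → ℝ) (x₀ T : ℝ) : Prop :=
  (∃ (U : Set (ℝ × ℝ)) (V E : ℝ → ℝ → ℝ) (x : ℝ → ℝ), IsOpen U ∧
    IsClassicalSolution c V₀ E₀ U V E ∧ IsCharacteristic V U x₀ T x) ∧
  ∀ (U : Set (ℝ × ℝ)) (V E : ℝ → ℝ → ℝ) (x : ℝ → ℝ), IsOpen U →
    IsClassicalSolution c V₀ E₀ U V E → IsCharacteristic V U x₀ T x →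
    Tendsto (fun t => |deriv (V t) (x t)| + |deriv (E t) (x t)|) (𝓝[<] T) atTop

end EulerPoisson

namespace EulerPoisson

/-! Along a characteristic `x' = V`, `V' = -E`, `E' = c(x) V`. If `Φ' = c`, then `E - Φ(x)` is
conserved, so each characteristic is a nonlinear oscillator `X'' = -(Φ(X) - k(a))`. Its energy is
conserved, so for small data it stays where `c'` has one sign and is bounded away from zero; there
`c` may be replaced by a globally well-behaved `γ`.

The Jacobian `J = ∂X/∂a` and `P = J'` satisfy `J(0) = 1` and `J'' = κ - γ(X) J`, where `κ = k'(a)`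
is the initial density, and differentiating in `a` gives `V_x = P / J`, `E_x = γ - κ / J`. While `J
> 0` the flow can be inverted near the trajectory, which yields a classical solution
(`IsFlow.exists_classicalSolution`); at the first zero of `J` the pair `(P, κ)` is nonzero, so the
gradients blow up. It remains to show that `J` vanishes in finite time.

This is `exists_nonpos_of_variation`. For `κ ≤ 0` a positive `J` would be concave, with `J'' ≤ -γ
J`, which is impossible. Let `κ > 0`. Since `V'' = -γ V`, the Wronskians `N = PV - JV' = PV + JE`
and `M = P'V - PV' = PE + (κ - γJ)V` obey `N' = κ V` and `M' = -γ' J V²`, with `γ' > 0` after a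
reflection. Hence `N - κ x` is constant and `N` is bounded, while `M` decreases as long as `J > 0`.
They are tied by `J (E² + γV²) = NE + κV² - MV`. If `M → -∞`, positivity of the left side makes `V`
almost nonnegative from some time on, impossible for a bounded oscillation of positive energy. If
`M` is bounded, take `W` bounded with `W' = V³`: for large `C` the bounded functional `N V³ / 3 + M
W - C M` has derivative at least `(4/3) κ V⁴`, whose integral diverges. -/

/-! ### Differential inequalities that force the Jacobian to vanish. -/

/-- A differentiable function whose derivative is at least `η` on `[t₀, ∞)` grows linearly. -/
theorem add_mul_le_of_le_deriv {f f' : ℝ → ℝ} {t₀ η : ℝ}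
    (hf : ∀ t, t₀ ≤ t → HasDerivAt f (f' t) t) (hη : ∀ t, t₀ ≤ t → η ≤ f' t) {t : ℝ}
    (ht : t₀ ≤ t) : f t₀ + η * (t - t₀) ≤ f t := by
  have h := (convex_Ici t₀).mul_sub_le_image_sub_of_le_deriv (f := f) (C := η)
    (fun s hs => (hf s hs).continuousAt.continuousWithinAt)
    (fun s hs => (hf s (interior_subset hs)).differentiableAt.differentiableWithinAt)
    (fun s hs => by rw [(hf s (interior_subset hs)).deriv]; exact hη s (interior_subset hs))
    t₀ self_mem_Ici t ht ht
  linarith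

theorem not_bounded_of_le_deriv {f f' : ℝ → ℝ} {t₀ η C : ℝ} (hη0 : 0 < η)
    (hf : ∀ t, t₀ ≤ t → HasDerivAt f (f' t) t) (hη : ∀ t, t₀ ≤ t → η ≤ f' t)
    (hC : ∀ t, t₀ ≤ t → f t ≤ C) : False := by
  have h1 := hC t₀ le_rfl
  set s := t₀ + (C - f t₀ + 1) / η with hs
  have hle : t₀ ≤ s := by
    have : 0 ≤ (C - f t₀ + 1) / η := by apply div_nonneg <;> linarith
    linarith
  have h2 := add_mul_le_of_le_deriv hf hη hle
  have h3 : η * (s - t₀) = C - f t₀ + 1 := by rw [hs]; field_simp; ring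
  linarith [hC s hle]

/-- A solution of `J'' = κ - γ J` with `κ ≤ 0` and `γ` bounded below by a positive constant cannot
stay positive. -/
theorem exists_nonpos_of_nonpos_forcing {γ J P : ℝ → ℝ} {κ γ₀ : ℝ} (hκ : κ ≤ 0) (hγ₀ : 0 < γ₀)
    (hγ : ∀ t, γ₀ ≤ γ t) (hJ : ∀ t, HasDerivAt J (P t) t)
    (hP : ∀ t, HasDerivAt P (κ - γ t * J t) t) : ∃ t, 0 ≤ t ∧ J t ≤ 0 := by
  by_contra! hpos
  have hP' : ∀ t, 0 ≤ t → γ₀ * J t ≤ -(κ - γ t * J t) := fun t ht => by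
    nlinarith [hpos t ht, hγ t]
  have hPnonneg : ∀ s, 0 ≤ s → 0 ≤ P s := by
    intro s hs
    by_contra! hneg
    refine not_bounded_of_le_deriv (f := fun t => -J t) (f' := fun t => -P t) (t₀ := s)
      (η := -P s) (C := 0) (by linarith) (fun t _ => (hJ t).neg) (fun t ht => ?_)
      (fun t ht => by have := hpos t (hs.trans ht); linarith)
    have := add_mul_le_of_le_deriv (f := fun t => -P t) (t₀ := s) (η := 0)
      (fun t _ => (hP t).neg) (fun t ht => by
        have := hP' t (hs.trans ht)
        have := mul_pos hγ₀ (hpos t (hs.trans ht))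
        linarith) ht
    linarith
  have hJ0 : ∀ t, 0 ≤ t → J 0 ≤ J t := fun t ht => by
    have := add_mul_le_of_le_deriv (f := J) (t₀ := 0) (η := 0) (fun t _ => hJ t)
      (fun t ht => hPnonneg t ht) ht
    linarith
  refine not_bounded_of_le_deriv (f := fun t => -P t) (t₀ := 0) (η := γ₀ * J 0) (C := 0)
      (mul_pos hγ₀ (hpos 0 le_rfl)) (fun t _ => (hP t).neg) (fun t ht => ?_)
      (fun t ht => by have := hPnonneg t ht; linarith)
  have := hP' t ht
  have := mul_le_mul_of_nonneg_left (hJ0 t ht) hγ₀.le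
  linarith

/-- Along an oscillation `x' = V`, `V' = -E`, `E' = γ V` in a medium with `γ' = b V`, where `b` is
bounded away from zero, a solution of `J'' = κ - γ J` cannot stay positive. -/
theorem exists_nonpos_of_variation {x V E γ b J P W : ℝ → ℝ} {κ γ₀ b₀ δ B : ℝ}
    (hx : ∀ t, HasDerivAt x (V t) t) (hV : ∀ t, HasDerivAt V (-E t) t)
    (hE : ∀ t, HasDerivAt E (γ t * V t) t) (hγ : ∀ t, HasDerivAt γ (b t * V t) t)
    (hJ : ∀ t, HasDerivAt J (P t) t) (hP : ∀ t, HasDerivAt P (κ - γ t * J t) t)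
    (hW : ∀ t, HasDerivAt W (V t ^ 3) t)
    (hγ₀ : 0 < γ₀) (hb₀ : 0 < b₀) (hδ : 0 < δ)
    (hxB : ∀ t, |x t| ≤ B) (hVB : ∀ t, |V t| ≤ B) (hEB : ∀ t, |E t| ≤ B) (hWB : ∀ t, |W t| ≤ B)
    (hγl : ∀ t, γ₀ ≤ γ t) (hγB : ∀ t, γ t ≤ B) (hbl : ∀ t, b₀ ≤ b t) (hbB : ∀ t, b t ≤ B)
    (hQ : ∀ t, δ ≤ γ t * V t ^ 2 + E t ^ 2) : ∃ t, 0 ≤ t ∧ J t ≤ 0 := by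
  rcases le_or_gt κ 0 with hκ | hκ
  · exact exists_nonpos_of_nonpos_forcing hκ hγ₀ hγl hJ hP
  by_contra! hpos
  have hB : 0 < B := hγ₀.trans_le ((hγl 0).trans (hγB 0))
  -- `VE` is bounded, so `γV²` and `E²` have the same time average; both contradictions below use it
  -- to trade one for the other.
  have hVE : ∀ t, HasDerivAt (fun t => V t * E t) (γ t * V t ^ 2 - E t ^ 2) t := fun t =>
    ((hV t).mul (hE t)).congr_deriv (by ring)
  set N : ℝ → ℝ := fun t => P t * V t + J t * E t with hNdef
  set M : ℝ → ℝ := fun t => P t * E t + (κ - γ t * J t) * V t with hMdef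
  have hN : ∀ t, HasDerivAt N (κ * V t) t := fun t =>
    (((hP t).mul (hV t)).add ((hJ t).mul (hE t))).congr_deriv (by ring)
  have hM : ∀ t, HasDerivAt M (-(b t * J t * V t ^ 2)) t := fun t =>
    (((hP t).mul (hE t)).add ((((hγ t).mul (hJ t)).const_sub κ).mul (hV t))).congr_deriv
      (by simp only [Pi.mul_apply]; ring)
  have hid : ∀ t, J t * (E t ^ 2 + γ t * V t ^ 2) = N t * E t + κ * V t ^ 2 - M t * V t :=
    fun t => by simp only [hNdef, hMdef]; ring
  obtain ⟨CN, hCN⟩ : ∃ CN, ∀ t, |N t| ≤ CN := by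
    have hd : ∀ t, HasDerivAt (fun t => N t - κ * x t) 0 t := fun t =>
      ((hN t).sub ((hx t).const_mul κ)).congr_deriv (by ring)
    have hconst : ∀ t, N t - κ * x t = N 0 - κ * x 0 := fun t =>
      is_const_of_deriv_eq_zero (f := fun t => N t - κ * x t)
        (fun t => (hd t).differentiableAt) (fun t => (hd t).deriv) t 0
    refine ⟨|N 0 - κ * x 0| + κ * B, fun t => ?_⟩
    have : N t = (N 0 - κ * x 0) + κ * x t := by linarith [hconst t]
    rw [this]
    refine (abs_add_le _ _).trans ?_
    rw [abs_mul κ, abs_of_pos hκ]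
    have := mul_le_mul_of_nonneg_left (hxB t) hκ.le
    linarith
  have hCN0 : 0 ≤ CN := (abs_nonneg _).trans (hCN 0)
  have hMdec' : ∀ s t, 0 ≤ s → s ≤ t → M t ≤ M s := fun s t hs ht => by
    have := add_mul_le_of_le_deriv (f := fun t => -M t) (t₀ := s) (η := 0)
      (fun t _ => (hM t).neg) (fun t ht => by
        have := mul_nonneg (mul_nonneg (hb₀.le.trans (hbl t)) (hpos t (hs.trans ht)).le)
          (sq_nonneg (V t))
        linarith) ht
    linarith
  have hMdec : ∀ t, 0 ≤ t → M t ≤ M 0 := fun t => hMdec' 0 t le_rfl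
  have hV2 : ∀ t, V t ^ 2 ≤ B ^ 2 := fun t => sq_le_sq' (abs_le.1 (hVB t)).1 (abs_le.1 (hVB t)).2
  have hE2 : ∀ t, E t ^ 2 ≤ B ^ 2 := fun t => sq_le_sq' (abs_le.1 (hEB t)).1 (abs_le.1 (hEB t)).2
  have hVEB : ∀ t, |V t * E t| ≤ B * B := fun t => by
    rw [abs_mul]; exact mul_le_mul (hVB t) (hEB t) (abs_nonneg _) hB.le
  by_cases hbdd : ∃ L, ∀ t, 0 ≤ t → -L ≤ M t
  · obtain ⟨L, hL⟩ := hbdd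
    -- `A` bounds `E² + γV² + bW`. Since `-M' = b J V²` with `b ≥ b₀`, the term `-(A / b₀) M`
    -- absorbs every contribution of the form `J V² (...)`.
    set A := B ^ 2 + B * B ^ 2 + B * B with hA
    have hA0 : 0 < A := by positivity
    set a := δ / (2 * B) with ha
    have ha0 : 0 < a := by positivity
    have hδa : δ = 2 * B * a := by rw [ha]; field_simp
    set CM := max |M 0| |L| with hCM
    have hMB : ∀ t, 0 ≤ t → |M t| ≤ CM := fun t ht => by
      rw [abs_le]
      constructor
      · linarith [hL t ht, le_abs_self L, le_max_right |M 0| |L|]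
      · linarith [hMdec t ht, le_abs_self (M 0), le_max_left |M 0| |L|]
    refine not_bounded_of_le_deriv (t₀ := 0) (η := 4 / 3 * κ * a ^ 2)
      (f := fun t => N t * V t ^ 3 / 3 + M t * W t - A / b₀ * M t
        - 4 / 3 * κ * (a / B) * (V t * E t))
      (f' := fun t => (κ * V t * V t ^ 3 + N t * (3 * V t ^ 2 * (-E t))) / 3
        + (-(b t * J t * V t ^ 2) * W t + M t * V t ^ 3) - A / b₀ * (-(b t * J t * V t ^ 2))
        - 4 / 3 * κ * (a / B) * (γ t * V t ^ 2 - E t ^ 2))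
      (C := CN * B ^ 3 / 3 + CM * B + A / b₀ * CM + 4 / 3 * κ * (a / B) * (B * B))
      (by positivity) (fun t _ => ?_) (fun t ht => ?_) (fun t ht => ?_)
    · have h3 : HasDerivAt (fun t => V t ^ 3) (3 * V t ^ 2 * (-E t)) t :=
        ((hV t).pow 3).congr_deriv (by norm_num)
      exact ((((hN t).mul h3).div_const 3).add ((hM t).mul (hW t))).sub ((hM t).const_mul _)
        |>.sub ((hVE t).const_mul _)
    · have hJV : 0 ≤ J t * V t ^ 2 := mul_nonneg (hpos t ht).le (sq_nonneg _)
      have hAb : E t ^ 2 + γ t * V t ^ 2 + b t * W t ≤ A / b₀ * b t := by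
        have h1 : A ≤ A / b₀ * b t := by
          rw [div_mul_eq_mul_div, le_div_iff₀ hb₀]
          exact mul_le_mul_of_nonneg_left (hbl t) hA0.le
        have h2 : γ t * V t ^ 2 ≤ B * B ^ 2 :=
          mul_le_mul (hγB t) (hV2 t) (sq_nonneg _) hB.le
        have h3 : b t * W t ≤ B * B := by
          refine (le_abs_self _).trans ?_
          rw [abs_mul, abs_of_nonneg (hb₀.le.trans (hbl t))]
          exact mul_le_mul (hbB t) (hWB t) (abs_nonneg _) hB.le
        linarith [hE2 t]
      have hmain := mul_nonneg hJV (sub_nonneg.2 hAb)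
      -- As `a = δ / (2B)`, the energy bound gives `γV² - E² ≤ 2B (V² - a)`; with `(V² - a)² ≥ 0`
      -- this bounds `V⁴` below by a positive constant plus a multiple of `(VE)'`, which the last
      -- term of the functional cancels.
      have hquart : a ^ 2 + a / B * (γ t * V t ^ 2 - E t ^ 2) ≤ V t ^ 4 := by
        have h1 : γ t * V t ^ 2 - E t ^ 2 ≤ 2 * B * (V t ^ 2 - a) := by
          have : γ t * V t ^ 2 ≤ B * V t ^ 2 := mul_le_mul_of_nonneg_right (hγB t) (sq_nonneg _)
          linarith [hQ t]
        have h2 := mul_le_mul_of_nonneg_left h1 (div_pos ha0 hB).le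
        have h3 : a / B * (2 * B * (V t ^ 2 - a)) = 2 * a * V t ^ 2 - 2 * a ^ 2 := by
          field_simp
        nlinarith [sq_nonneg (V t ^ 2 - a)]
      have hq := mul_le_mul_of_nonneg_left hquart (by positivity : 0 ≤ 4 / 3 * κ)
      have hid2 := congrArg (fun z => z * V t ^ 2) (hid t)
      have heq : (κ * V t * V t ^ 3 + N t * (3 * V t ^ 2 * (-E t))) / 3
          + (-(b t * J t * V t ^ 2) * W t + M t * V t ^ 3) - A / b₀ * (-(b t * J t * V t ^ 2))
          = 4 / 3 * κ * V t ^ 4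
            + J t * V t ^ 2 * (A / b₀ * b t - (E t ^ 2 + γ t * V t ^ 2 + b t * W t)) := by
        linear_combination -hid2
      rw [heq]
      linarith
    · have hV3 : |V t ^ 3| ≤ B ^ 3 := by rw [abs_pow]; gcongr; exact hVB t
      have hCM0 : 0 ≤ CM := (abs_nonneg _).trans (hMB t ht)
      have h1 : N t * V t ^ 3 ≤ CN * B ^ 3 := by
        refine (le_abs_self _).trans ?_
        rw [abs_mul]; exact mul_le_mul (hCN t) hV3 (abs_nonneg _) hCN0
      have h2 : M t * W t ≤ CM * B := by
        refine (le_abs_self _).trans ?_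
        rw [abs_mul]; exact mul_le_mul (hMB t ht) (hWB t) (abs_nonneg _) hCM0
      have h3 : -(A / b₀ * M t) ≤ A / b₀ * CM := by
        have := mul_le_mul_of_nonneg_left (neg_le_of_abs_le (hMB t ht)) (div_pos hA0 hb₀).le
        linarith
      have h4 : -(4 / 3 * κ * (a / B) * (V t * E t)) ≤ 4 / 3 * κ * (a / B) * (B * B) := by
        have := mul_le_mul_of_nonneg_left (neg_le_of_abs_le (hVEB t))
          (by positivity : 0 ≤ 4 / 3 * κ * (a / B))
        linarith
      linarith
  · push Not at hbdd
    set C₀ := CN * B + κ * B ^ 2 with hC₀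
    have hC₀0 : 0 < C₀ := by positivity
    have hMV : ∀ t, 0 ≤ t → M t * V t ≤ C₀ := fun t ht => by
      have h1 : 0 ≤ J t * (E t ^ 2 + γ t * V t ^ 2) := mul_nonneg (hpos t ht).le
        (by linarith [hQ t])
      rw [hid t] at h1
      have h2 : N t * E t ≤ CN * B := by
        refine (le_abs_self _).trans ?_
        rw [abs_mul]; exact mul_le_mul (hCN t) (hEB t) (abs_nonneg _) hCN0
      have h3 := mul_le_mul_of_nonneg_left (hV2 t) hκ.le
      linarith
    -- Chosen so that `-η ≤ V ≤ B`, through `(V + η)(B - V) ≥ 0`, makes the derivative of `2(B - η)E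
    -- - VE` at least `δ - 2B²η = δ / 2`.
    set η := δ / (4 * B ^ 2) with hη
    have hη0 : 0 < η := by positivity
    have hδη : δ = 4 * B ^ 2 * η := by rw [hη]; field_simp
    obtain ⟨s, hs, hMs⟩ := hbdd (C₀ / η)
    have hVη : ∀ t, s ≤ t → -η ≤ V t := fun t ht => by
      by_contra! hlt
      have h1 := hMdec' s t hs ht
      have h2 : C₀ / η < -M t := by linarith
      have h3 : C₀ / η * η < -M t * -V t := by
        have hpos' : 0 < C₀ / η := by positivity
        exact mul_lt_mul'' h2 (by linarith) hpos'.le hη0.le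
      rw [div_mul_cancel₀ _ hη0.ne'] at h3
      linarith [hMV t (hs.trans ht)]
    refine not_bounded_of_le_deriv (t₀ := s) (η := δ / 2)
      (f := fun t => 2 * (B - η) * E t - V t * E t)
      (f' := fun t => 2 * (B - η) * (γ t * V t) - (γ t * V t ^ 2 - E t ^ 2))
      (C := |2 * (B - η)| * B + B * B)
      (by positivity) (fun t _ => ((hE t).const_mul _).sub (hVE t)) (fun t ht => ?_)
      (fun t ht => ?_)
    · have h1 : 0 ≤ (V t + η) * (B - V t) := mul_nonneg (by linarith [hVη t ht])
        (by linarith [(abs_le.1 (hVB t)).2])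
      have h2 := mul_nonneg (hγ₀.le.trans (hγl t)) h1
      have h3 : γ t * (B * η) ≤ B * (B * η) := mul_le_mul_of_nonneg_right (hγB t) (by positivity)
      have := hQ t
      nlinarith
    · have h1 : 2 * (B - η) * E t ≤ |2 * (B - η)| * B := by
        refine (le_abs_self _).trans ?_
        rw [abs_mul]; exact mul_le_mul_of_nonneg_left (hEB t) (abs_nonneg _)
      have := neg_le_of_abs_le (hVEB t)
      linarith

/-! ### Grönwall estimates and global solutions of planar equations. -/

/-- Grönwall's inequality on both sides of the initial time, with a bound that is linear in the
initial value and in the inhomogeneity. -/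
theorem norm_le_of_norm_deriv_le {F : Type*} [NormedAddCommGroup F] [NormedSpace ℝ F]
    {w w' : ℝ → F} {K T δ ε : ℝ} (hK : 0 ≤ K)
    (hw : ∀ t, |t| ≤ T → HasDerivWithinAt w (w' t) (Icc (-T) T) t)
    (h0 : ‖w 0‖ ≤ δ) (hb : ∀ t, |t| ≤ T → ‖w' t‖ ≤ K * ‖w t‖ + ε)
    (hδ : 0 ≤ δ) (hε : 0 ≤ ε) {t : ℝ} (ht : |t| ≤ T) :
    ‖w t‖ ≤ (δ + ε) * Real.exp ((K + 1) * T) := by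
  have hT : 0 ≤ T := (abs_nonneg t).trans ht
  have key : ∀ (v v' : ℝ → F), (∀ t ∈ Icc 0 T, HasDerivWithinAt v (v' t) (Icc 0 T) t) →
      ‖v 0‖ ≤ δ → (∀ t ∈ Icc 0 T, ‖v' t‖ ≤ K * ‖v t‖ + ε) → ∀ t ∈ Icc 0 T,
      ‖v t‖ ≤ (δ + ε) * Real.exp ((K + 1) * T) := by
    intro v v' hv hv0 hvb t ht
    have h1 := norm_le_gronwallBound_of_norm_deriv_right_le (f := v) (f' := v') (δ := δ)
      (K := K + 1) (ε := ε) (a := 0) (b := T) (fun s hs => (hv s hs).continuousWithinAt)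
      (fun s hs => (hv s (Ico_subset_Icc_self hs)).mono_of_mem_nhdsWithin
        (mem_of_superset (Icc_mem_nhdsGE hs.2) (Icc_subset_Icc_left hs.1)))
      hv0 (fun s hs => (hvb s (Ico_subset_Icc_self hs)).trans
        (by nlinarith [norm_nonneg (v s)])) t ht
    refine h1.trans ?_
    -- The rate `K + 1` instead of `K` covers `K = 0` and gives `ε / (K + 1) ≤ ε`.
    rw [gronwallBound_of_K_ne_0 (by linarith : K + 1 ≠ 0)]
    have hexp1 : 1 ≤ Real.exp ((K + 1) * t) := Real.one_le_exp (by nlinarith [ht.1])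
    have hexp2 : Real.exp ((K + 1) * t) ≤ Real.exp ((K + 1) * T) :=
      Real.exp_le_exp.2 (by nlinarith [ht.2])
    simp only [sub_zero]
    have h3 : ε / (K + 1) ≤ ε := div_le_self hε (by linarith)
    have h4 : ε / (K + 1) * (Real.exp ((K + 1) * t) - 1) ≤ ε * Real.exp ((K + 1) * t) := by
      apply mul_le_mul h3 (by linarith) (by linarith) hε
    have h5 := mul_le_mul_of_nonneg_left hexp2 (by linarith : 0 ≤ δ + ε)
    linarith
  rcases le_total 0 t with h | h
  · refine key w w' (fun s hs => (hw s ?_).mono (Icc_subset_Icc_left (by linarith))) h0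
      (fun s hs => hb s ?_) t ⟨h, (abs_le.1 ht).2⟩
    · rw [abs_of_nonneg hs.1]; exact hs.2
    · rw [abs_of_nonneg hs.1]; exact hs.2
  · have := key (fun s => w (-s)) (fun s => -w' (-s)) (fun s hs => ?_) (by simpa using h0)
      (fun s hs => ?_) (-t) ⟨by linarith, by linarith [(abs_le.1 ht).1]⟩
    · simpa using this
    · have h1 : |-s| ≤ T := by rw [abs_neg, abs_of_nonneg hs.1]; exact hs.2
      have h2 := (hw (-s) h1).scomp (h := fun s => -s) (h' := -1) (s := Icc 0 T) s
        ((hasDerivAt_neg s).hasDerivWithinAt)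
        (fun r hr => ⟨by linarith [hr.2], by linarith [hr.1, hr.2]⟩)
      simpa [Function.comp_def] using h2
    · have h1 : |-s| ≤ T := by rw [abs_neg, abs_of_nonneg hs.1]; exact hs.2
      simpa using hb (-s) h1

/-- The radial cut-off of the plane (in the sup norm). -/
theorem exists_cutoff (R : ℝ) (hR : 0 ≤ R) : ∃ χ : ℝ × ℝ → ℝ × ℝ, LipschitzWith 1 χ ∧
    (∀ y, ‖χ y‖ ≤ R) ∧ (∀ y, ‖χ y‖ ≤ ‖y‖) ∧ ∀ y, ‖y‖ ≤ R → χ y = y := by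
  have hle : -R ≤ R := by linarith
  have hLip : LipschitzWith 1 (fun s : ℝ => (projIcc (-R) R hle s : ℝ)) :=
    LipschitzWith.projIcc hle
  have h0 : (projIcc (-R) R hle 0 : ℝ) = 0 := by
    rw [projIcc_of_mem hle (show (0 : ℝ) ∈ Icc (-R) R from ⟨by linarith, hR⟩)]
  have habs : ∀ s : ℝ, |(projIcc (-R) R hle s : ℝ)| ≤ |s| := fun s => by
    have := hLip.dist_le_mul s 0
    simpa [h0, Real.dist_eq] using this
  refine ⟨fun y => (projIcc (-R) R hle y.1, projIcc (-R) R hle y.2), ?_, fun y => ?_, fun y => ?_,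
    fun y hy => ?_⟩
  · have h1 : LipschitzWith 1 (fun y : ℝ × ℝ => (projIcc (-R) R hle y.1 : ℝ)) := by
      simpa [Function.comp_def] using hLip.comp LipschitzWith.prod_fst
    have h2 : LipschitzWith 1 (fun y : ℝ × ℝ => (projIcc (-R) R hle y.2 : ℝ)) := by
      simpa [Function.comp_def] using hLip.comp LipschitzWith.prod_snd
    simpa using h1.prodMk h2
  · exact norm_prod_le_iff.2 ⟨abs_le.2 (projIcc (-R) R hle y.1).2,
      abs_le.2 (projIcc (-R) R hle y.2).2⟩
  · exact norm_prod_le_iff.2 ⟨(habs y.1).trans (norm_fst_le y), (habs y.2).trans (norm_snd_le y)⟩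
  · have h1 : |y.1| ≤ R := (norm_fst_le y).trans hy
    have h2 : |y.2| ≤ R := (norm_snd_le y).trans hy
    ext
    · simp [projIcc_of_mem hle (abs_le.1 h1)]
    · simp [projIcc_of_mem hle (abs_le.1 h2)]

/-- An ODE in the plane whose right-hand side is Lipschitz in the unknown has solutions on every
bounded interval of time. -/
theorem exists_solution_Icc {f : ℝ → ℝ × ℝ → ℝ × ℝ} {K : NNReal} (hf : ∀ t, LipschitzWith K (f t))
    (hc : ∀ y, Continuous fun t => f t y) (y₀ : ℝ × ℝ) {T : ℝ} (hT : 0 ≤ T) :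
    ∃ α : ℝ → ℝ × ℝ, α 0 = y₀ ∧
      ∀ t ∈ Icc (-T) T, HasDerivWithinAt α (f t (α t)) (Icc (-T) T) t := by
  obtain ⟨m, hm⟩ := (isCompact_Icc (a := -T) (b := T)).exists_bound_of_continuousOn
    (hc 0).continuousOn
  have hm0 : 0 ≤ m := (norm_nonneg _).trans (hm 0 ⟨by linarith, hT⟩)
  have hfb : ∀ t ∈ Icc (-T) T, ∀ y, ‖f t y‖ ≤ K * ‖y‖ + m := fun t ht y => by
    have h1 := (hf t).dist_le_mul y 0
    rw [dist_eq_norm, dist_zero_right] at h1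
    have h2 := norm_le_norm_sub_add (f t y) (f t 0)
    linarith [hm t ht]
  set R := (‖y₀‖ + m) * Real.exp ((K + 1) * T) with hR
  have hR0 : 0 ≤ R := by positivity
  obtain ⟨χ, hχL, hχR, hχn, hχ⟩ := exists_cutoff R hR0
  obtain ⟨Lc, hLc⟩ : ∃ Lc : NNReal, (Lc : ℝ) = K * R + m := ⟨⟨K * R + m, by positivity⟩, rfl⟩
  obtain ⟨a, ha⟩ : ∃ a : NNReal, (a : ℝ) = (K * R + m) * T :=
    ⟨⟨(K * R + m) * T, by positivity⟩, rfl⟩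
  have h0mem : (0 : ℝ) ∈ Icc (-T) T := ⟨by linarith, hT⟩
  -- The truncated field is bounded, so Picard–Lindelöf reaches all of `[-T, T]`. Since `‖χ y‖ ≤
  -- ‖y‖`, truncation keeps the linear growth bound; Grönwall then keeps the solution within radius
  -- `R`, where `χ` is the identity.
  have hPL : IsPicardLindelof (fun t y => f t (χ y)) (⟨0, h0mem⟩ : Icc (-T) T) y₀ a 0 Lc K :=
    { lipschitzOnWith := fun t _ => by
        simpa [Function.comp_def] using ((hf t).comp hχL).lipschitzOnWith
      continuousOn := fun y _ => (hc _).continuousOn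
      norm_le := fun t ht y _ => (hfb t ht _).trans (by
        have := mul_le_mul_of_nonneg_left (hχR y) K.coe_nonneg
        rw [hLc]; linarith)
      mul_max_le := by simp [hLc, ha] }
  obtain ⟨α, hα0, hα⟩ := hPL.exists_eq_forall_mem_Icc_hasDerivWithinAt₀
  refine ⟨α, hα0, fun t ht => ?_⟩
  have hbound : ‖α t‖ ≤ R := by
    have hα0' : α 0 = y₀ := hα0
    refine norm_le_of_norm_deriv_le (w := α) (w' := fun t => f t (χ (α t))) (K := K) (δ := ‖y₀‖)
      (ε := m) K.2 (fun s hs => hα s (abs_le.1 hs)) (by rw [hα0']) (fun s hs => ?_)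
      (norm_nonneg _) hm0 (abs_le.2 ht)
    refine (hfb s (abs_le.1 hs) _).trans ?_
    have := mul_le_mul_of_nonneg_left (hχn (α s)) K.coe_nonneg
    linarith
  have h := hα t ht
  simp only [hχ _ hbound] at h
  exact h

/-- An ODE in the plane whose right-hand side is Lipschitz in the unknown has global solutions. -/
theorem exists_global_solution {f : ℝ → ℝ × ℝ → ℝ × ℝ} {K : NNReal}
    (hf : ∀ t, LipschitzWith K (f t)) (hc : ∀ y, Continuous fun t => f t y) (y₀ : ℝ × ℝ) :
    ∃ α : ℝ → ℝ × ℝ, α 0 = y₀ ∧ ∀ t, HasDerivAt α (f t (α t)) t := by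
  -- With radius `n + 1`, each `t` lies strictly inside the interval of index `⌊|t|⌋₊`, so two-sided
  -- derivatives are available.
  choose α hα0 hα using fun n : ℕ => exists_solution_Icc hf hc y₀ (T := (n : ℝ) + 1) (by positivity)
  have hda : ∀ (n : ℕ) (t : ℝ), |t| < n + 1 → HasDerivAt (α n) (f t (α n t)) t := fun n t ht =>
    (hα n t (abs_le.1 ht.le)).hasDerivAt (Icc_mem_nhds (abs_lt.1 ht).1 (abs_lt.1 ht).2)
  have huniq : ∀ (n m : ℕ) (t : ℝ), |t| < n + 1 → |t| < m + 1 → α n t = α m t := by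
    intro n m t hn hm
    set c : ℝ := min (n + 1) (m + 1) with hcdef
    have hc0 : 0 < c := lt_min (by positivity) (by positivity)
    refine ODE_solution_unique_of_mem_Ioo (v := f) (s := fun _ => univ) (K := K) (a := -c) (b := c)
      (t₀ := 0) (fun t _ => (hf t).lipschitzOnWith) ⟨by linarith, hc0⟩
      (fun s hs => ⟨hda n s ((abs_lt.2 hs).trans_le (min_le_left _ _)), mem_univ _⟩)
      (fun s hs => ⟨hda m s ((abs_lt.2 hs).trans_le (min_le_right _ _)), mem_univ _⟩)
      (by rw [hα0, hα0]) (abs_lt.1 (lt_min hn hm))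
  have hfl : ∀ t : ℝ, |t| < ⌊|t|⌋₊ + 1 := fun t => Nat.lt_floor_add_one _
  refine ⟨fun t => α ⌊|t|⌋₊ t, by simp [hα0], fun t => ?_⟩
  set n := ⌊|t|⌋₊ with hn
  have hev : (fun s => α ⌊|s|⌋₊ s) =ᶠ[𝓝 t] α n := by
    have hopen : {s : ℝ | |s| < n + 1} ∈ 𝓝 t :=
      (isOpen_lt continuous_abs continuous_const).mem_nhds (hfl t)
    filter_upwards [hopen] with s hs
    exact huniq _ _ s (hfl s) hs
  exact (hda n t (hfl t)).congr_of_eventuallyEq hev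

/-! ### Differentiable dependence of the flow on the initial point. -/

/-- A function of two real variables with continuous partial derivatives is `C¹`. -/
theorem contDiff_one_of_partials {f f₁ f₂ : ℝ → ℝ → ℝ}
    (h₁ : ∀ t a, HasDerivAt (fun s => f s a) (f₁ t a) t)
    (h₂ : ∀ t a, HasDerivAt (fun b => f t b) (f₂ t a) a)
    (c₁ : Continuous (Function.uncurry f₁)) (c₂ : Continuous (Function.uncurry f₂)) :
    ContDiff ℝ 1 (Function.uncurry f) ∧ ∀ t a, HasFDerivAt (Function.uncurry f)
      (f₁ t a • ContinuousLinearMap.fst ℝ ℝ ℝ + f₂ t a • ContinuousLinearMap.snd ℝ ℝ ℝ) (t, a) := by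
  have hd : ∀ p : ℝ × ℝ, HasFDerivAt (Function.uncurry f)
      (f₁ p.1 p.2 • ContinuousLinearMap.fst ℝ ℝ ℝ + f₂ p.1 p.2 • ContinuousLinearMap.snd ℝ ℝ ℝ)
      p := by
    intro p
    have h := hasStrictFDerivAt_uncurry_coprod (𝕜 := ℝ) (u := p) (f := f)
      (f₁ := fun t a => f₁ t a • ContinuousLinearMap.id ℝ ℝ)
      (f₂ := fun t a => f₂ t a • ContinuousLinearMap.id ℝ ℝ)
      (Eventually.of_forall fun v => by
        simpa [Function.HasUncurry.uncurry] using
            (h₁ v.1 v.2).hasFDerivAt.congr_fderiv (g' := f₁ v.1 v.2 • ContinuousLinearMap.id ℝ ℝ)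
              (by ext; simp))
      (Eventually.of_forall fun v => by
        simpa [Function.HasUncurry.uncurry] using
            (h₂ v.1 v.2).hasFDerivAt.congr_fderiv (g' := f₂ v.1 v.2 • ContinuousLinearMap.id ℝ ℝ)
              (by ext; simp))
      ((c₁.smul continuous_const).continuousAt) ((c₂.smul continuous_const).continuousAt)
    refine h.hasFDerivAt.congr_fderiv ?_
    ext <;> simp [Function.HasUncurry.uncurry]
  refine ⟨?_, fun t a => hd (t, a)⟩
  rw [contDiff_one_iff_fderiv]
  refine ⟨fun p => (hd p).differentiableAt, ?_⟩
  have : fderiv ℝ (Function.uncurry f) = fun p : ℝ × ℝ =>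
      f₁ p.1 p.2 • ContinuousLinearMap.fst ℝ ℝ ℝ + f₂ p.1 p.2 • ContinuousLinearMap.snd ℝ ℝ ℝ :=
    funext fun p => (hd p).fderiv
  rw [this]
  exact (c₁.smul continuous_const).add (c₂.smul continuous_const)

/-- Grönwall's inequality for a scalar second-order equation. -/
theorem abs_le_of_second_order {u v h : ℝ → ℝ} {C T δ ε : ℝ} (hC : 0 ≤ C)
    (hu : ∀ t, HasDerivAt u (v t) t) (hv : ∀ t, HasDerivAt v (h t) t)
    (hu0 : |u 0| ≤ δ) (hv0 : |v 0| ≤ δ) (hh : ∀ t, |t| ≤ T → |h t| ≤ C * |u t| + ε)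
    (hε : 0 ≤ ε) {t : ℝ} (ht : |t| ≤ T) :
    |u t| ≤ (δ + ε) * Real.exp ((C + 2) * T) ∧ |v t| ≤ (δ + ε) * Real.exp ((C + 2) * T) := by
  have hb := norm_le_of_norm_deriv_le (w := fun t => (u t, v t)) (w' := fun t => (v t, h t))
    (K := C + 1) (T := T) (δ := δ) (ε := ε) (by linarith)
    (fun t _ => ((hu t).prodMk (hv t)).hasDerivWithinAt) (norm_prod_le_iff.2 ⟨hu0, hv0⟩)
    (fun s hs => by
      have h1 : |u s| ≤ ‖(u s, v s)‖ := norm_fst_le (u s, v s)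
      have h2 : |v s| ≤ ‖(u s, v s)‖ := norm_snd_le (u s, v s)
      refine norm_prod_le_iff.2 ⟨?_, ?_⟩
      · simp only [Real.norm_eq_abs]
        nlinarith [norm_nonneg (u s, v s)]
      · simp only [Real.norm_eq_abs]
        nlinarith [norm_nonneg (u s, v s), hh s hs])
    ((abs_nonneg _).trans hu0) hε ht
  rw [show C + 1 + 1 = C + 2 by ring] at hb
  exact ⟨(norm_fst_le (u t, v t)).trans hb, (norm_snd_le (u t, v t)).trans hb⟩

/-- Joint continuity from continuity in `t` and continuity in `a` locally uniform in `t`. -/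
theorem continuous_uncurry_of_locally_uniform {F : ℝ → ℝ → ℝ} (h : ∀ a, Continuous fun t => F t a)
    (hD : ∀ a T, ∃ D : ℝ → ℝ, Tendsto D (𝓝 a) (𝓝 0) ∧ ∀ b t, |t| ≤ T → |F t b - F t a| ≤ D b) :
    Continuous (Function.uncurry F) := by
  rw [continuous_iff_continuousAt]
  rintro ⟨t₀, a₀⟩
  obtain ⟨D, hD0, hDb⟩ := hD a₀ (|t₀| + 1)
  have h1 : Tendsto (fun p : ℝ × ℝ => F p.1 p.2 - F p.1 a₀) (𝓝 (t₀, a₀)) (𝓝 0) := by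
    have hev : ∀ᶠ p : ℝ × ℝ in 𝓝 (t₀, a₀), |p.1| < |t₀| + 1 :=
      (continuous_fst.abs.tendsto (t₀, a₀)).eventually_lt_const (by simp)
    refine squeeze_zero_norm' (hev.mono fun p hp => hDb p.2 p.1 hp.le) ?_
    exact hD0.comp (continuous_snd.tendsto (t₀, a₀))
  have h2 : Tendsto (fun p : ℝ × ℝ => F p.1 a₀) (𝓝 (t₀, a₀)) (𝓝 (F t₀ a₀)) :=
    ((h a₀).tendsto t₀).comp (continuous_fst.tendsto (t₀, a₀))
  have h3 := h1.add h2
  simp only [sub_add_cancel, zero_add] at h3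
  exact h3

/-- The mean value inequality applied to `Φ - γ(x) · id`. The quadratic remainder makes the
linearization error of the flow negligible. -/
theorem abs_sub_sub_le_of_lipschitz_deriv {Φ γ : ℝ → ℝ} {L : NNReal}
    (hΦ : ∀ x, HasDerivAt Φ (γ x) x) (hL : LipschitzWith L γ) (x y : ℝ) :
    |Φ y - Φ x - γ x * (y - x)| ≤ L * |y - x| ^ 2 := by
  have h := (convex_uIcc x y).norm_image_sub_le_of_norm_hasDerivWithin_le
    (f := fun s => Φ s - γ x * s) (f' := fun s => γ s - γ x) (C := L * |y - x|) (x := x) (y := y)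
    (fun s _ => (((hΦ s).sub ((hasDerivAt_id s).const_mul (γ x))).congr_deriv
      (by simp)).hasDerivWithinAt)
    (fun s hs => by
      have h1 := hL.dist_le_mul s x
      rw [Real.dist_eq, Real.dist_eq] at h1
      refine h1.trans (mul_le_mul_of_nonneg_left ?_ L.coe_nonneg)
      exact abs_sub_left_of_mem_uIcc hs) left_mem_uIcc right_mem_uIcc
  simp only [Real.norm_eq_abs] at h
  calc |Φ y - Φ x - γ x * (y - x)| = |Φ y - γ x * y - (Φ x - γ x * x)| := by congr 1; ring
    _ ≤ L * |y - x| * |y - x| := h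
    _ = L * |y - x| ^ 2 := by ring

/-- The flow `X'' = -(Φ(X) - k(a))`, `X(0) = a`, `X'(0) = V₀(a)` for a potential force `Φ` with
bounded Lipschitz derivative `γ`: it is global and continuously differentiable, and `J = ∂X/∂a`
solves the linearized equation. -/
structure IsFlow (γ Φ k k' V₀ V₀' : ℝ → ℝ) (X V J P : ℝ → ℝ → ℝ) : Prop where
  X_zero : ∀ a, X 0 a = a
  V_zero : ∀ a, V 0 a = V₀ a
  J_zero : ∀ a, J 0 a = 1
  P_zero : ∀ a, P 0 a = V₀' a
  dX : ∀ t a, HasDerivAt (fun s => X s a) (V t a) t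
  dV : ∀ t a, HasDerivAt (fun s => V s a) (-(Φ (X t a) - k a)) t
  dJ : ∀ t a, HasDerivAt (fun s => J s a) (P t a) t
  dP : ∀ t a, HasDerivAt (fun s => P s a) (k' a - γ (X t a) * J t a) t
  daX : ∀ t a, HasDerivAt (fun b => X t b) (J t a) a
  daV : ∀ t a, HasDerivAt (fun b => V t b) (P t a) a
  contX : Continuous (Function.uncurry X)
  contV : Continuous (Function.uncurry V)
  contJ : Continuous (Function.uncurry J)
  contP : Continuous (Function.uncurry P)

/-- The trajectories `y` and the solutions `z` of the linearized equation are constructed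
separately. Grönwall applied to `y b - y a - (b - a) z a` identifies `z` as the derivative in `a`;
since the estimates are uniform on bounded times, they also give joint continuity. -/
theorem exists_isFlow {γ Φ k k' V₀ V₀' : ℝ → ℝ} {L : NNReal} {C : ℝ} (hL : LipschitzWith L γ)
    (hC : ∀ x, |γ x| ≤ C) (hΦ : ∀ x, HasDerivAt Φ (γ x) x)
    (hk : ∀ a, HasDerivAt k (k' a) a) (hk' : Continuous k')
    (hV₀ : ∀ a, HasDerivAt V₀ (V₀' a) a) (hV₀' : Continuous V₀') :
    ∃ X V J P, IsFlow γ Φ k k' V₀ V₀' X V J P := by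
  have hC0 : 0 ≤ C := (abs_nonneg _).trans (hC 0)
  obtain ⟨K, hK⟩ : ∃ K : NNReal, (K : ℝ) = C := ⟨⟨C, hC0⟩, rfl⟩
  have hΦL : ∀ x y, |Φ y - Φ x| ≤ C * |y - x| := fun x y => by
    have := convex_univ.norm_image_sub_le_of_norm_hasDerivWithin_le (f := Φ) (f' := γ) (C := C)
      (x := x) (y := y) (fun s _ => (hΦ s).hasDerivWithinAt) (fun s _ => hC s) (mem_univ _)
      (mem_univ _)
    simpa using this
  have hfL : ∀ (a : ℝ) (_ : ℝ), LipschitzWith (K + 1)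
      (fun y : ℝ × ℝ => (y.2, -(Φ y.1 - k a))) := fun a _ => by
    refine LipschitzWith.of_dist_le_mul fun y z => ?_
    rw [dist_eq_norm, dist_eq_norm]
    have h1 : |y.1 - z.1| ≤ ‖y - z‖ := norm_fst_le (y - z)
    have h2 : |y.2 - z.2| ≤ ‖y - z‖ := norm_snd_le (y - z)
    push_cast
    rw [hK]
    refine norm_prod_le_iff.2 ⟨?_, ?_⟩
    · simp only [Prod.fst_sub, Real.norm_eq_abs]
      nlinarith [norm_nonneg (y - z)]
    · simp only [Prod.snd_sub, Real.norm_eq_abs]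
      have h3 := hΦL y.1 z.1
      rw [show -(Φ y.1 - k a) - -(Φ z.1 - k a) = Φ z.1 - Φ y.1 by ring]
      rw [abs_sub_comm z.1] at h3
      nlinarith [norm_nonneg (y - z)]
  choose y hy0 hy using fun a => exists_global_solution (hfL a) (fun _ => continuous_const) (a, V₀ a)
  have dX : ∀ t a, HasDerivAt (fun s => (y a s).1) (y a t).2 t := fun t a => (hy a t).fst
  have dV : ∀ t a, HasDerivAt (fun s => (y a s).2) (-(Φ (y a t).1 - k a)) t := fun t a =>
    (hy a t).snd
  have hXc : ∀ a, Continuous fun t => (y a t).1 := fun a =>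
    continuous_iff_continuousAt.2 fun t => (dX t a).continuousAt
  have hgL : ∀ (a t : ℝ), LipschitzWith (K + 1)
      (fun z : ℝ × ℝ => (z.2, k' a - γ (y a t).1 * z.1)) := fun a t => by
    refine LipschitzWith.of_dist_le_mul fun w z => ?_
    rw [dist_eq_norm, dist_eq_norm]
    have h1 : |w.1 - z.1| ≤ ‖w - z‖ := norm_fst_le (w - z)
    have h2 : |w.2 - z.2| ≤ ‖w - z‖ := norm_snd_le (w - z)
    push_cast
    rw [hK]
    refine norm_prod_le_iff.2 ⟨?_, ?_⟩
    · simp only [Prod.fst_sub, Real.norm_eq_abs]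
      nlinarith [norm_nonneg (w - z)]
    · simp only [Prod.snd_sub, Real.norm_eq_abs]
      rw [show k' a - γ (y a t).1 * w.1 - (k' a - γ (y a t).1 * z.1)
        = -(γ (y a t).1 * (w.1 - z.1)) by ring, abs_neg, abs_mul]
      nlinarith [norm_nonneg (w - z), mul_le_mul (hC (y a t).1) h1 (abs_nonneg _) hC0]
  choose z hz0 hz using fun a => exists_global_solution (hgL a)
    (fun w => continuous_const.prodMk (continuous_const.sub
      ((hL.continuous.comp (hXc a)).mul continuous_const))) ((1 : ℝ), V₀' a)
  have dJ : ∀ t a, HasDerivAt (fun s => (z a s).1) (z a t).2 t := fun t a => (hz a t).fst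
  have dP : ∀ t a, HasDerivAt (fun s => (z a s).2) (k' a - γ (y a t).1 * (z a t).1) t :=
    fun t a => (hz a t).snd
  -- `D a b` collects the dependence on the initial point: position, velocity and force constant. It
  -- is `O(b - a)`, so the quadratic remainder, of size `D²`, is `o(b - a)`.
  set D : ℝ → ℝ → ℝ := fun a b => |b - a| + |V₀ b - V₀ a| + |k b - k a| with hD
  have hDT : ∀ a, Tendsto (D a) (𝓝 a) (𝓝 0) := fun a => by
    have h1 : Continuous (D a) := by
      have := continuous_iff_continuousAt.2 fun b => (hk b).continuousAt
      have := continuous_iff_continuousAt.2 fun b => (hV₀ b).continuousAt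
      fun_prop
    simpa [hD] using h1.tendsto a
  have hDnn : ∀ a b, 0 ≤ D a b := fun a b => by positivity
  have hDO : ∀ a, D a =O[𝓝 a] fun b => b - a := fun a =>
    ((Asymptotics.isBigO_refl (fun b => b - a) _).norm_left.add
      (hV₀ a).isBigO_sub.norm_left).add (hk a).isBigO_sub.norm_left
  have hLipa : ∀ a b T t, |t| ≤ T →
      |(y b t).1 - (y a t).1| ≤ D a b * Real.exp ((C + 2) * T) ∧
      |(y b t).2 - (y a t).2| ≤ D a b * Real.exp ((C + 2) * T) := fun a b T t ht => by
    refine abs_le_of_second_order (u := fun t => (y b t).1 - (y a t).1)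
      (v := fun t => (y b t).2 - (y a t).2) (δ := |b - a| + |V₀ b - V₀ a|) (ε := |k b - k a|)
      hC0 (fun t => (dX t b).sub (dX t a)) (fun t => (dV t b).sub (dV t a)) ?_ ?_ ?_
      (abs_nonneg _) ht
    · simp only [hy0]; linarith [abs_nonneg (V₀ b - V₀ a)]
    · simp only [hy0]; linarith [abs_nonneg (b - a)]
    · intro s _
      rw [show -(Φ (y b s).1 - k b) - -(Φ (y a s).1 - k a)
        = -(Φ (y b s).1 - Φ (y a s).1) + (k b - k a) by ring]
      refine (abs_add_le _ _).trans ?_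
      rw [abs_neg]
      linarith [hΦL (y a s).1 (y b s).1]
  have hlittle : ∀ (f f' : ℝ → ℝ), (∀ a, HasDerivAt f (f' a) a) → ∀ a,
      (fun b => |f b - f a - (b - a) * f' a|) =o[𝓝 a] fun b => b - a := fun f f' hf a => by
    simpa using (hasDerivAt_iff_isLittleO.1 (hf a)).norm_left
  have hda : ∀ a T, ∃ R : ℝ → ℝ, R =o[𝓝 a] (fun b => b - a) ∧ ∀ b t, |t| ≤ T →
      |(y b t).1 - (y a t).1 - (b - a) * (z a t).1| ≤ R b ∧
      |(y b t).2 - (y a t).2 - (b - a) * (z a t).2| ≤ R b := fun a T => by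
    set G := Real.exp ((C + 2) * T) with hG
    refine ⟨fun b => (|V₀ b - V₀ a - (b - a) * V₀' a| + (L * (D a b * G) ^ 2
      + |k b - k a - (b - a) * k' a|)) * G, ?_, fun b t ht => ?_⟩
    · have h1 : (fun b => L * (D a b * G) ^ 2) =o[𝓝 a] fun b => b - a := by
        have h2 : (fun b => D a b * D a b) =o[𝓝 a] fun b => (1 : ℝ) * (b - a) :=
          ((Asymptotics.isLittleO_one_iff ℝ).2 (hDT a)).mul_isBigO (hDO a)
        have h3 := h2.const_mul_left (L * G ^ 2)
        simp only [one_mul] at h3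
        refine h3.congr_left fun b => by ring
      have h4 := ((hlittle V₀ V₀' hV₀ a).add (h1.add (hlittle k k' hk a))).const_mul_left G
      exact h4.congr_left fun b => by ring
    · refine abs_le_of_second_order (u := fun t => (y b t).1 - (y a t).1 - (b - a) * (z a t).1)
        (v := fun t => (y b t).2 - (y a t).2 - (b - a) * (z a t).2) hC0
        (fun t => ((dX t b).sub (dX t a)).sub ((dJ t a).const_mul _))
        (fun t => ((dV t b).sub (dV t a)).sub ((dP t a).const_mul _)) ?_ ?_ ?_ (by positivity) ht
      · simp [hy0, hz0]
      · simp [hy0, hz0]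
      · intro s hs
        have e1 := abs_sub_sub_le_of_lipschitz_deriv hΦ hL (y a s).1 (y b s).1
        have e2 : |(y b s).1 - (y a s).1| ^ 2 ≤ (D a b * G) ^ 2 :=
          pow_le_pow_left₀ (abs_nonneg _) (hLipa a b T s hs).1 2
        have e3 := mul_le_mul_of_nonneg_left e2 L.coe_nonneg
        have e4 := mul_le_mul_of_nonneg_right (hC (y a s).1)
          (abs_nonneg ((y b s).1 - (y a s).1 - (b - a) * (z a s).1))
        rw [← abs_mul] at e4
        rw [show -(Φ (y b s).1 - k b) - -(Φ (y a s).1 - k a)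
            - (b - a) * (k' a - γ (y a s).1 * (z a s).1)
          = -(Φ (y b s).1 - Φ (y a s).1 - γ (y a s).1 * ((y b s).1 - (y a s).1))
            + (-(γ (y a s).1 * ((y b s).1 - (y a s).1 - (b - a) * (z a s).1))
            + (k b - k a - (b - a) * k' a)) by ring]
        refine (abs_add_le _ _).trans ?_
        have := abs_add_le (-(γ (y a s).1 * ((y b s).1 - (y a s).1 - (b - a) * (z a s).1)))
          (k b - k a - (b - a) * k' a)
        rw [abs_neg] at this ⊢
        linarith
  -- Only continuity in `a` is needed for `J` and `P`, so no rate is claimed: `V₀'` and `k'` are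
  -- merely continuous.
  have hDz : ∀ a T, ∃ R : ℝ → ℝ, Tendsto R (𝓝 a) (𝓝 0) ∧ ∀ b t, |t| ≤ T →
      |(z b t).1 - (z a t).1| ≤ R b ∧ |(z b t).2 - (z a t).2| ≤ R b := fun a T => by
    set G := Real.exp ((C + 2) * T) with hG
    have hJc : Continuous fun t => (z a t).1 :=
      continuous_iff_continuousAt.2 fun t => (dJ t a).continuousAt
    obtain ⟨m, hm⟩ := (isCompact_Icc (a := -T) (b := T)).exists_bound_of_continuousOn
      hJc.continuousOn
    refine ⟨fun b => (|V₀' b - V₀' a| + (|k' b - k' a| + L * (D a b * G) * |m|)) * G, ?_,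
      fun b t ht => ?_⟩
    · have h1 : Tendsto (fun b => |V₀' b - V₀' a|) (𝓝 a) (𝓝 0) := by
        have : Continuous fun b => |V₀' b - V₀' a| := by fun_prop
        simpa using this.tendsto a
      have h2 : Tendsto (fun b => |k' b - k' a|) (𝓝 a) (𝓝 0) := by
        have : Continuous fun b => |k' b - k' a| := by fun_prop
        simpa using this.tendsto a
      have h3 : Tendsto (fun b => L * (D a b * G) * |m|) (𝓝 a) (𝓝 0) := by
        simpa using (((hDT a).mul_const G).const_mul (L : ℝ)).mul_const |m|
      simpa using (h1.add (h2.add h3)).mul_const G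
    · refine abs_le_of_second_order (u := fun t => (z b t).1 - (z a t).1)
        (v := fun t => (z b t).2 - (z a t).2) hC0 (fun t => (dJ t b).sub (dJ t a))
        (fun t => (dP t b).sub (dP t a)) ?_ ?_ ?_ (by have := hDnn a b; positivity) ht
      · simp [hz0]
      · simp [hz0]
      · intro s hs
        have e1 := hL.dist_le_mul (y b s).1 (y a s).1
        rw [Real.dist_eq, Real.dist_eq] at e1
        have e2 := e1.trans (mul_le_mul_of_nonneg_left (hLipa a b T s hs).1 L.coe_nonneg)
        have e3 : |(z a s).1| ≤ |m| := (hm s (abs_le.1 hs)).trans (le_abs_self m)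
        have e4 := mul_le_mul e2 e3 (abs_nonneg _) (by have := hDnn a b; positivity)
        rw [← abs_mul] at e4
        have e5 := mul_le_mul_of_nonneg_right (hC (y b s).1) (abs_nonneg ((z b s).1 - (z a s).1))
        rw [← abs_mul] at e5
        rw [show k' b - γ (y b s).1 * (z b s).1 - (k' a - γ (y a s).1 * (z a s).1)
          = -(γ (y b s).1 * ((z b s).1 - (z a s).1)) + ((k' b - k' a)
            + -((γ (y b s).1 - γ (y a s).1) * (z a s).1)) by ring]
        have e6 := abs_add_le (-(γ (y b s).1 * ((z b s).1 - (z a s).1))) ((k' b - k' a)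
            + -((γ (y b s).1 - γ (y a s).1) * (z a s).1))
        have e7 := abs_add_le (k' b - k' a) (-((γ (y b s).1 - γ (y a s).1) * (z a s).1))
        rw [abs_neg] at e6 e7
        linarith
  have hDy : ∀ a T, ∃ R : ℝ → ℝ, Tendsto R (𝓝 a) (𝓝 0) ∧ ∀ b t, |t| ≤ T →
      |(y b t).1 - (y a t).1| ≤ R b ∧ |(y b t).2 - (y a t).2| ≤ R b := fun a T =>
    ⟨fun b => D a b * Real.exp ((C + 2) * T), by
      simpa using (hDT a).mul_const (Real.exp ((C + 2) * T)), fun b t ht => hLipa a b T t ht⟩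
  refine ⟨fun t a => (y a t).1, fun t a => (y a t).2, fun t a => (z a t).1, fun t a => (z a t).2,
    { X_zero := fun a => by simp [hy0]
      V_zero := fun a => by simp [hy0]
      J_zero := fun a => by simp [hz0]
      P_zero := fun a => by simp [hz0]
      dX := dX
      dV := dV
      dJ := dJ
      dP := dP
      daX := fun t a => ?_
      daV := fun t a => ?_
      contX := ?_
      contV := ?_
      contJ := ?_
      contP := ?_ }⟩
  · obtain ⟨R, hR, hRb⟩ := hda a |t|
    rw [hasDerivAt_iff_isLittleO]
    refine (Asymptotics.IsBigO.of_bound 1 (Eventually.of_forall fun b => ?_)).trans_isLittleO hR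
    have := (hRb b t le_rfl).1
    simp only [smul_eq_mul, Real.norm_eq_abs, one_mul]
    exact this.trans (le_abs_self _)
  · obtain ⟨R, hR, hRb⟩ := hda a |t|
    rw [hasDerivAt_iff_isLittleO]
    refine (Asymptotics.IsBigO.of_bound 1 (Eventually.of_forall fun b => ?_)).trans_isLittleO hR
    have := (hRb b t le_rfl).2
    simp only [smul_eq_mul, Real.norm_eq_abs, one_mul]
    exact this.trans (le_abs_self _)
  · refine continuous_uncurry_of_locally_uniform hXc fun a T => ?_
    obtain ⟨R, hR, hRb⟩ := hDy a T
    exact ⟨R, hR, fun b t ht => (hRb b t ht).1⟩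
  · refine continuous_uncurry_of_locally_uniform
      (fun a => continuous_iff_continuousAt.2 fun t => (dV t a).continuousAt) fun a T => ?_
    obtain ⟨R, hR, hRb⟩ := hDy a T
    exact ⟨R, hR, fun b t ht => (hRb b t ht).2⟩
  · refine continuous_uncurry_of_locally_uniform
      (fun a => continuous_iff_continuousAt.2 fun t => (dJ t a).continuousAt) fun a T => ?_
    obtain ⟨R, hR, hRb⟩ := hDz a T
    exact ⟨R, hR, fun b t ht => (hRb b t ht).1⟩
  · refine continuous_uncurry_of_locally_uniform
      (fun a => continuous_iff_continuousAt.2 fun t => (dP t a).continuousAt) fun a T => ?_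
    obtain ⟨R, hR, hRb⟩ := hDz a T
    exact ⟨R, hR, fun b t ht => (hRb b t ht).2⟩

/-! ### Energy bounds for the oscillator. -/

/-- A mean value theorem indifferent to the order of `x` and `y`; the sign condition records that
`ξ` lies on the same side of `x` as `y`. -/
theorem exists_sub_eq_mul_sub {Φ γ : ℝ → ℝ} (hΦ : ∀ x, HasDerivAt Φ (γ x) x) {x y : ℝ}
    (hxy : x ≠ y) : ∃ ξ, Φ y - Φ x = γ ξ * (y - x) ∧ 0 < (ξ - x) * (y - x) := by
  have hc : Continuous Φ := continuous_iff_continuousAt.2 fun x => (hΦ x).continuousAt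
  rcases lt_or_gt_of_ne hxy with h | h
  · obtain ⟨ξ, hξ, he⟩ := exists_hasDerivAt_eq_slope Φ γ h hc.continuousOn fun s _ => hΦ s
    refine ⟨ξ, ?_, mul_pos (by linarith [hξ.1]) (by linarith)⟩
    rw [he, div_mul_cancel₀ _ (by linarith : y - x ≠ 0)]
  · obtain ⟨ξ, hξ, he⟩ := exists_hasDerivAt_eq_slope Φ γ h hc.continuousOn fun s _ => hΦ s
    refine ⟨ξ, ?_, mul_pos_of_neg_of_neg (by linarith [hξ.2]) (by linarith)⟩
    have : x - y ≠ 0 := by linarith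
    rw [he]
    field_simp
    ring

/-- `f'` has the sign of `s - p`, so `p` is a global minimum. It serves to squeeze the potential
energy between two parabolas. -/
theorem nonneg_of_mul_deriv_nonneg {f f' : ℝ → ℝ} {p : ℝ} (hf : ∀ s, HasDerivAt f (f' s) s)
    (h0 : f p = 0) (h : ∀ s, 0 ≤ f' s * (s - p)) (x : ℝ) : 0 ≤ f x := by
  by_cases hx : p = x
  · rw [← hx, h0]
  obtain ⟨ξ, h1, h2⟩ := exists_sub_eq_mul_sub hf hx
  rw [h0, sub_zero] at h1
  rw [h1]
  have h3 := mul_nonneg (h ξ) (sq_nonneg (x - p))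
  rw [show f' ξ * (ξ - p) * (x - p) ^ 2 = f' ξ * (x - p) * ((ξ - p) * (x - p)) by ring] at h3
  exact nonneg_of_mul_nonneg_left h3 h2

/-- Energy estimates for the oscillator `x'' = -(Φ(x) - k)` with `c₀ ≤ Φ' ≤ c₁`: the amplitude is
controlled by the data, and the speed and the force do not vanish simultaneously. -/
theorem oscillator_bounds {γ Φ x V : ℝ → ℝ} {k c₀ c₁ : ℝ} (hc₀ : 0 < c₀) (hγ₀ : ∀ s, c₀ ≤ γ s)
    (hγ₁ : ∀ s, γ s ≤ c₁) (hΦ : ∀ s, HasDerivAt Φ (γ s) s) (hx : ∀ t, HasDerivAt x (V t) t)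
    (hV : ∀ t, HasDerivAt V (-(Φ (x t) - k)) t) :
    (∀ t, (x t - x 0) ^ 2 ≤
      4 / c₀ * (1 + c₁ / c₀ ^ 2) * (V 0 ^ 2 + (Φ (x 0) - k) ^ 2)) ∧
    ((V 0, Φ (x 0) - k) ≠ (0, 0) → ∃ δ > 0, ∀ t, δ ≤ γ (x t) * V t ^ 2 + (Φ (x t) - k) ^ 2) ∧
    ∃ (W : ℝ → ℝ) (B : ℝ), (∀ t, HasDerivAt W (V t ^ 3) t) ∧ ∀ t, |x t| ≤ B ∧ |V t| ≤ B ∧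
      |Φ (x t) - k| ≤ B ∧ |W t| ≤ B := by
  have hc₁ : 0 < c₁ := hc₀.trans_le ((hγ₀ 0).trans (hγ₁ 0))
  have hΦc : Continuous Φ := continuous_iff_continuousAt.2 fun x => (hΦ x).continuousAt
  obtain ⟨p, hp⟩ : ∃ p, Φ p = k := by
    refine mem_range_of_exists_le_of_exists_ge hΦc ⟨-|Φ 0 - k| / c₀, ?_⟩ ⟨|Φ 0 - k| / c₀, ?_⟩
    · by_cases h : (0 : ℝ) = -|Φ 0 - k| / c₀
      · rw [← h]
        have : |Φ 0 - k| = 0 := by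
          field_simp at h; linarith
        linarith [abs_eq_zero.1 this]
      · obtain ⟨ξ, h1, -⟩ := exists_sub_eq_mul_sub hΦ h
        have h2 : γ ξ * (-|Φ 0 - k| / c₀ - 0) ≤ c₀ * (-|Φ 0 - k| / c₀ - 0) := by
          apply mul_le_mul_of_nonpos_right (hγ₀ ξ)
          have : 0 ≤ |Φ 0 - k| / c₀ := by positivity
          rw [neg_div]; linarith
        have h3 : c₀ * (-|Φ 0 - k| / c₀ - 0) = -|Φ 0 - k| := by field_simp; ring
        linarith [le_abs_self (Φ 0 - k)]
    · by_cases h : (0 : ℝ) = |Φ 0 - k| / c₀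
      · rw [← h]
        have : |Φ 0 - k| = 0 := by
          field_simp at h; linarith
        linarith [abs_eq_zero.1 this]
      · obtain ⟨ξ, h1, -⟩ := exists_sub_eq_mul_sub hΦ h
        have h2 : c₀ * (|Φ 0 - k| / c₀ - 0) ≤ γ ξ * (|Φ 0 - k| / c₀ - 0) := by
          apply mul_le_mul_of_nonneg_right (hγ₀ ξ)
          have : 0 ≤ |Φ 0 - k| / c₀ := by positivity
          linarith
        have h3 : c₀ * (|Φ 0 - k| / c₀ - 0) = |Φ 0 - k| := by field_simp; ring
        linarith [neg_abs_le (Φ 0 - k)]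
  have hΦp : ∀ s, ∃ g, c₀ ≤ g ∧ g ≤ c₁ ∧ Φ s - k = g * (s - p) := fun s => by
    by_cases h : p = s
    · exact ⟨c₀, le_rfl, (hγ₀ 0).trans (hγ₁ 0), by rw [← h, hp]; ring⟩
    · obtain ⟨ξ, h1, -⟩ := exists_sub_eq_mul_sub hΦ h
      exact ⟨γ ξ, hγ₀ ξ, hγ₁ ξ, by rw [← h1, hp]⟩
  -- The potential energy, normalized at the equilibrium `p`; both `F` and `(Φ - k)²` are comparable
  -- to `(s - p)²`.
  set F : ℝ → ℝ := fun s => ∫ r in p..s, (Φ r - k) with hF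
  have hFd : ∀ s, HasDerivAt F (Φ s - k) s := fun s =>
    (hΦc.sub continuous_const).integral_hasStrictDerivAt p s |>.hasDerivAt
  have hFp : F p = 0 := by simp [hF]
  have hsqd : ∀ (c s : ℝ), HasDerivAt (fun s => c / 2 * (s - p) ^ 2) (c * (s - p)) s := fun c s =>
    ((((hasDerivAt_id s).sub_const p).pow 2).const_mul (c / 2)).congr_deriv (by simp; ring)
  have hFl : ∀ s, c₀ / 2 * (s - p) ^ 2 ≤ F s := fun s => by
    have := nonneg_of_mul_deriv_nonneg (p := p) (fun s => (hFd s).sub (hsqd c₀ s))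
      (by simp [hFp]) (fun s => by
        obtain ⟨g, h1, -, h3⟩ := hΦp s
        rw [h3, show (g * (s - p) - c₀ * (s - p)) * (s - p) = (g - c₀) * (s - p) ^ 2 by ring]
        exact mul_nonneg (by linarith) (sq_nonneg _)) s
    simp only [Pi.sub_apply] at this
    linarith
  have hFu : ∀ s, F s ≤ c₁ / 2 * (s - p) ^ 2 := fun s => by
    have := nonneg_of_mul_deriv_nonneg (p := p) (fun s => (hsqd c₁ s).sub (hFd s))
      (by simp [hFp]) (fun s => by
        obtain ⟨g, -, h2, h3⟩ := hΦp s
        rw [h3, show (c₁ * (s - p) - g * (s - p)) * (s - p) = (c₁ - g) * (s - p) ^ 2 by ring]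
        exact mul_nonneg (by linarith) (sq_nonneg _)) s
    simp only [Pi.sub_apply] at this
    linarith
  have hΦl : ∀ s, c₀ ^ 2 * (s - p) ^ 2 ≤ (Φ s - k) ^ 2 := fun s => by
    obtain ⟨g, h1, -, h3⟩ := hΦp s
    rw [h3, mul_pow]
    exact mul_le_mul_of_nonneg_right (pow_le_pow_left₀ hc₀.le h1 2) (sq_nonneg _)
  have hΦu : ∀ s, (Φ s - k) ^ 2 ≤ c₁ ^ 2 * (s - p) ^ 2 := fun s => by
    obtain ⟨g, h1, h2, h3⟩ := hΦp s
    rw [h3, mul_pow]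
    exact mul_le_mul_of_nonneg_right (pow_le_pow_left₀ (hc₀.le.trans h1) h2 2) (sq_nonneg _)
  set h := V 0 ^ 2 / 2 + F (x 0) with hh
  have hen : ∀ t, V t ^ 2 / 2 + F (x t) = h := fun t => by
    have hd : ∀ t, HasDerivAt (fun t => V t ^ 2 / 2 + F (x t)) 0 t := fun t =>
      ((((hV t).pow 2).div_const 2).add ((hFd (x t)).comp t (hx t))).congr_deriv
        (by norm_num; ring)
    exact is_const_of_deriv_eq_zero (f := fun t => V t ^ 2 / 2 + F (x t))
      (fun t => (hd t).differentiableAt) (fun t => (hd t).deriv) t 0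
  have hxp : ∀ t, (x t - p) ^ 2 ≤ 2 * h / c₀ := fun t => by
    rw [le_div_iff₀ hc₀]
    nlinarith [hen t, hFl (x t), sq_nonneg (V t)]
  have hh0 : 0 ≤ h := by
    have := hFl (x 0)
    have : 0 ≤ c₀ / 2 * (x 0 - p) ^ 2 := by positivity
    have := sq_nonneg (V 0)
    linarith
  refine ⟨fun t => ?_, fun hne => ?_, ?_⟩
  · have h1 : (x t - x 0) ^ 2 ≤ 8 * h / c₀ := by
      have h2 := hxp t
      have h3 := hxp 0
      have h4 : 8 * h / c₀ = 2 * (2 * h / c₀) + 2 * (2 * h / c₀) := by ring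
      nlinarith [sq_nonneg ((x t - p) + (x 0 - p))]
    refine h1.trans ?_
    have h5 : h ≤ (1 + c₁ / c₀ ^ 2) / 2 * (V 0 ^ 2 + (Φ (x 0) - k) ^ 2) := by
      have h6 := hFu (x 0)
      have h7 : c₁ * (x 0 - p) ^ 2 ≤ c₁ / c₀ ^ 2 * (Φ (x 0) - k) ^ 2 := by
        rw [div_mul_eq_mul_div, le_div_iff₀ (by positivity)]
        nlinarith [hΦl (x 0)]
      have h8 : 0 ≤ c₁ / c₀ ^ 2 * V 0 ^ 2 := by positivity
      have h9 := sq_nonneg (Φ (x 0) - k)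
      rw [hh]
      linarith
    have h10 := mul_le_mul_of_nonneg_left h5 (by positivity : 0 ≤ 8 / c₀)
    calc 8 * h / c₀ = 8 / c₀ * h := by ring
      _ ≤ _ := h10
      _ = _ := by ring
  · have hhpos : 0 < h := by
      have h1 := hFl (x 0)
      have h2 : 0 ≤ c₀ / 2 * (x 0 - p) ^ 2 := by positivity
      by_contra! hle
      have h3 : V 0 ^ 2 = 0 := by linarith [sq_nonneg (V 0)]
      have h4 : c₀ / 2 * (x 0 - p) ^ 2 = 0 := by linarith [sq_nonneg (V 0)]
      have h5 : (x 0 - p) ^ 2 = 0 := by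
        rcases mul_eq_zero.1 h4 with h | h
        · linarith
        · exact h
      have h6 := hΦu (x 0)
      rw [h5, mul_zero] at h6
      have h7 : (Φ (x 0) - k) ^ 2 = 0 := le_antisymm h6 (sq_nonneg _)
      exact hne (by rw [pow_eq_zero_iff two_ne_zero |>.1 h3, pow_eq_zero_iff two_ne_zero |>.1 h7])
    -- From `2F ≤ c₁ (x - p)²` and `c₀² (x - p)² ≤ (Φ - k)²`, so that the conserved energy `h`
    -- bounds the quadratic form from below.
    refine ⟨2 * c₀ ^ 2 / c₁ * h, by positivity, fun t => ?_⟩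
    rw [div_mul_eq_mul_div, div_le_iff₀ hc₁, ← hen t]
    have h01 : c₀ ≤ c₁ := (hγ₀ 0).trans (hγ₁ 0)
    have h1 : c₀ * V t ^ 2 ≤ γ (x t) * V t ^ 2 :=
      mul_le_mul_of_nonneg_right (hγ₀ _) (sq_nonneg _)
    have h2 := mul_le_mul_of_nonneg_left (hFu (x t)) (by positivity : 0 ≤ 2 * c₀ ^ 2)
    have h3 := mul_le_mul_of_nonneg_right (h1) hc₁.le
    have h4 := mul_le_mul_of_nonneg_right (hΦl (x t)) hc₁.le
    have h5 : c₀ ^ 2 * V t ^ 2 ≤ c₀ * V t ^ 2 * c₁ := by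
      have := mul_le_mul_of_nonneg_left h01 (by positivity : 0 ≤ c₀ * V t ^ 2)
      linarith
    linarith
  · have hFc : Continuous F := continuous_iff_continuousAt.2 fun x => (hFd x).continuousAt
    -- By energy conservation `V² = 2h - 2F(x)`, so `V³ = (2h - 2F(x)) x'` is the derivative of
    -- `G(x)`, which is bounded because `x` is.
    set G : ℝ → ℝ := fun s => ∫ r in (0 : ℝ)..s, (2 * h - 2 * F r) with hG
    have hGd : ∀ s, HasDerivAt G (2 * h - 2 * F s) s := fun s =>
      (continuous_const.sub (continuous_const.mul hFc)).integral_hasStrictDerivAt 0 s |>.hasDerivAt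
    have hGc : Continuous G := continuous_iff_continuousAt.2 fun x => (hGd x).continuousAt
    have habs : ∀ (y : ℝ) {b : ℝ}, y ^ 2 ≤ b → |y| ≤ 1 + b := fun y b hb =>
      abs_le.2 ⟨by nlinarith [sq_nonneg (y + 1)], by nlinarith [sq_nonneg (y - 1)]⟩
    set R := 1 + 2 * h / c₀ with hR
    have hxR : ∀ t, x t ∈ Icc (p - R) (p + R) := fun t => by
      have := abs_le.1 (habs _ (hxp t))
      exact ⟨by linarith, by linarith⟩
    obtain ⟨m, hm⟩ := (isCompact_Icc (a := p - R) (b := p + R)).exists_bound_of_continuousOn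
      hGc.continuousOn
    obtain ⟨m₂, hm₂⟩ := (isCompact_Icc (a := p - R) (b := p + R)).exists_bound_of_continuousOn
      continuousOn_id
    refine ⟨fun t => G (x t), max (max m₂ (1 + 2 * h)) (max (1 + c₁ ^ 2 * (2 * h / c₀)) m),
      fun t => ?_, fun t => ⟨?_, ?_, ?_, ?_⟩⟩
    · refine ((hGd (x t)).comp t (hx t)).congr_deriv ?_
      rw [← hen t]; ring
    · exact (hm₂ _ (hxR t)).trans ((le_max_left _ _).trans (le_max_left _ _))
    · refine (habs (V t) (b := 2 * h) ?_).trans ((le_max_right _ _).trans (le_max_left _ _))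
      have : 0 ≤ c₀ / 2 * (x t - p) ^ 2 := by positivity
      linarith [hen t, hFl (x t)]
    · refine (habs _ (b := c₁ ^ 2 * (2 * h / c₀)) ?_).trans
        ((le_max_left _ _).trans (le_max_right _ _))
      exact (hΦu _).trans (mul_le_mul_of_nonneg_left (hxp t) (sq_nonneg _))
    · exact (hm _ (hxR t)).trans ((le_max_right _ _).trans (le_max_right _ _))

/-! ### Vanishing of the Jacobian along the flow. -/

/-- The Jacobian `J = ∂X/∂a` of the flow degenerates in finite time along a trajectory that runs
through a region where `γ'` is bounded away from zero. -/
theorem IsFlow.exists_jacobian_nonpos {γ Φ k k' V₀ V₀' b : ℝ → ℝ} {X V J P : ℝ → ℝ → ℝ}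
    (hfl : IsFlow γ Φ k k' V₀ V₀' X V J P) {c₀ c₁ b₀ b₁ σ a : ℝ} (hc₀ : 0 < c₀)
    (hγ₀ : ∀ s, c₀ ≤ γ s) (hγ₁ : ∀ s, γ s ≤ c₁) (hΦ : ∀ s, HasDerivAt Φ (γ s) s)
    (hne : (V₀ a, Φ a - k a) ≠ (0, 0)) (hσ : σ = 1 ∨ σ = -1) (hb₀ : 0 < b₀)
    (hb : ∀ t, HasDerivAt γ (b (X t a)) (X t a)) (hbl : ∀ t, b₀ ≤ σ * b (X t a))
    (hbu : ∀ t, σ * b (X t a) ≤ b₁) : ∃ t, 0 ≤ t ∧ J t a ≤ 0 := by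
  obtain ⟨-, h2, W, B, hW, hB⟩ := oscillator_bounds (k := k a) hc₀ hγ₀ hγ₁ hΦ
    (fun t => hfl.dX t a) (fun t => hfl.dV t a)
  obtain ⟨δ, hδ, hQ⟩ := h2 (by rw [hfl.X_zero, hfl.V_zero]; exact hne)
  have hσ2 : σ * σ = 1 := by rcases hσ with rfl | rfl <;> norm_num
  have hσa : |σ| = 1 := by rcases hσ with rfl | rfl <;> norm_num
  have hσ3 : σ ^ 3 = σ := by rw [pow_succ, pow_two, hσ2, one_mul]
  set B' := max (max B c₁) b₁ with hB'
  have hBB : B ≤ B' := (le_max_left _ _).trans (le_max_left _ _)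
  -- For `σ = -1` this is the reflection `x ↦ -x`: the quantities `x`, `V`, `E`, `W` and `γ'` change
  -- sign, while `γ`, `J`, `P`, `κ` do not.
  refine exists_nonpos_of_variation (x := fun t => σ * X t a) (V := fun t => σ * V t a)
    (E := fun t => σ * (Φ (X t a) - k a)) (γ := fun t => γ (X t a)) (b := fun t => σ * b (X t a))
    (J := fun t => J t a) (P := fun t => P t a) (W := fun t => σ * W t) (κ := k' a) (γ₀ := c₀)
    (b₀ := b₀) (δ := δ) (B := B') (fun t => (hfl.dX t a).const_mul σ)
    (fun t => ((hfl.dV t a).const_mul σ).congr_deriv (by ring))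
    (fun t => ((((hΦ _).comp t (hfl.dX t a)).sub_const (k a)).const_mul σ).congr_deriv (by ring))
    (fun t => ((hb t).comp t (hfl.dX t a)).congr_deriv (by
      linear_combination (-b (X t a) * V t a) * hσ2))
    (fun t => hfl.dJ t a) (fun t => hfl.dP t a)
    (fun t => ((hW t).const_mul σ).congr_deriv (by rw [mul_pow, hσ3])) hc₀ hb₀ hδ
    (fun t => ?_) (fun t => ?_) (fun t => ?_) (fun t => ?_) (fun t => hγ₀ _)
    (fun t => (hγ₁ _).trans ((le_max_right _ _).trans (le_max_left _ _))) hbl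
    (fun t => (hbu t).trans (le_max_right _ _)) (fun t => ?_)
  · rw [abs_mul, hσa, one_mul]; exact (hB t).1.trans hBB
  · rw [abs_mul, hσa, one_mul]; exact (hB t).2.1.trans hBB
  · rw [abs_mul, hσa, one_mul]; exact (hB t).2.2.1.trans hBB
  · rw [abs_mul, hσa, one_mul]; exact (hB t).2.2.2.trans hBB
  · rw [mul_pow, mul_pow, pow_two σ, hσ2, one_mul, one_mul]; exact hQ t

/-! ### Calculus on relatively open subsets of the half-plane `t ≥ 0`. -/

theorem uniqueDiffOn_halfPlane : UniqueDiffOn ℝ {p : ℝ × ℝ | 0 ≤ p.1} := by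
  have h := (uniqueDiffOn_Ici (0 : ℝ)).prod (uniqueDiffOn_univ (𝕜 := ℝ) (E := ℝ))
  convert h using 1
  ext p
  simp

section Partials

variable {F : ℝ → ℝ → ℝ} {U : Set (ℝ × ℝ)}

theorem hasFDerivWithinAt_halfPlane (hU : IsOpen U)
    (hF : ContDiffOn ℝ 1 (Function.uncurry F) (U ∩ {p | 0 ≤ p.1})) {t a : ℝ} (ht : 0 ≤ t)
    (hta : (t, a) ∈ U) : HasFDerivWithinAt (Function.uncurry F)
      (fderivWithin ℝ (Function.uncurry F) (U ∩ {p | 0 ≤ p.1}) (t, a)) {p | 0 ≤ p.1} (t, a) := by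
  have h := ((hF.differentiableOn one_ne_zero) (t, a) ⟨hta, ht⟩).hasFDerivWithinAt
  rw [inter_comm] at h ⊢
  exact (hasFDerivWithinAt_inter (hU.mem_nhds hta)).1 h

theorem hasDerivWithinAt_curve (hU : IsOpen U)
    (hF : ContDiffOn ℝ 1 (Function.uncurry F) (U ∩ {p | 0 ≤ p.1})) {y : ℝ → ℝ} {y' t : ℝ}
    (ht : 0 ≤ t) (hta : (t, y t) ∈ U) (hy : HasDerivWithinAt y y' (Ici 0) t) :
    HasDerivWithinAt (fun s => F s (y s))
      (fderivWithin ℝ (Function.uncurry F) (U ∩ {p | 0 ≤ p.1}) (t, y t) (1, y')) (Ici 0) t := by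
  have h := hasFDerivWithinAt_halfPlane hU hF ht hta
  exact h.comp_hasDerivWithinAt t (f := fun s => (s, y s)) ((hasDerivWithinAt_id t _).prodMk hy)
    (fun s hs => hs)

theorem hasDerivAt_space (hU : IsOpen U)
    (hF : ContDiffOn ℝ 1 (Function.uncurry F) (U ∩ {p | 0 ≤ p.1})) {t a : ℝ} (ht : 0 ≤ t)
    (hta : (t, a) ∈ U) : HasDerivAt (F t)
      (fderivWithin ℝ (Function.uncurry F) (U ∩ {p | 0 ≤ p.1}) (t, a) (0, 1)) a := by
  have h := hasFDerivWithinAt_halfPlane hU hF ht hta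
  have h2 := h.comp_hasDerivWithinAt (s := univ) a (f := fun b => (t, b))
    ((hasDerivWithinAt_const a univ t).prodMk (hasDerivWithinAt_id a univ)) (fun s hs => ht)
  exact hasDerivWithinAt_univ.1 h2

theorem fderivWithin_apply_one (hU : IsOpen U)
    (hF : ContDiffOn ℝ 1 (Function.uncurry F) (U ∩ {p | 0 ≤ p.1})) {t a : ℝ} (ht : 0 ≤ t)
    (hta : (t, a) ∈ U) (r : ℝ) :
    fderivWithin ℝ (Function.uncurry F) (U ∩ {p | 0 ≤ p.1}) (t, a) (1, r)
      = derivWithin (fun s => F s a) (Ici 0) t + r * deriv (F t) a := by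
  rw [(hasDerivAt_space hU hF ht hta).deriv,
    (hasDerivWithinAt_curve (y := fun _ => a) hU hF ht hta
      (hasDerivWithinAt_const t _ a)).derivWithin (uniqueDiffOn_Ici 0 t ht),
    show ((1 : ℝ), r) = (1, 0) + r • ((0 : ℝ), (1 : ℝ)) by ext <;> simp, map_add, map_smul,
    smul_eq_mul]

theorem continuousOn_deriv_space (hU : IsOpen U)
    (hF : ContDiffOn ℝ 1 (Function.uncurry F) (U ∩ {p | 0 ≤ p.1})) {y : ℝ → ℝ} {T : ℝ}
    (hy : ContinuousOn y (Icc 0 T)) (hyU : ∀ s ∈ Icc 0 T, (s, y s) ∈ U) :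
    ContinuousOn (fun s => deriv (F s) (y s)) (Icc 0 T) := by
  have hud : UniqueDiffOn ℝ (U ∩ {p : ℝ × ℝ | 0 ≤ p.1}) := by
    rw [inter_comm]; exact uniqueDiffOn_halfPlane.inter hU
  have h1 := hF.continuousOn_fderivWithin hud le_rfl
  have h2 : ContinuousOn (fun s => fderivWithin ℝ (Function.uncurry F) (U ∩ {p | 0 ≤ p.1})
      (s, y s)) (Icc 0 T) :=
    h1.comp (continuousOn_id.prodMk hy) (fun s hs => ⟨hyU s hs, hs.1⟩)
  have h3 := h2.clm_apply (continuousOn_const (c := ((0 : ℝ), (1 : ℝ))))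
  exact h3.congr fun s hs => (hasDerivAt_space hU hF hs.1 (hyU s hs)).deriv

end Partials

/-! ### Classical solutions along characteristics. -/

variable {c V₀ E₀ : ℝ → ℝ} {U : Set (ℝ × ℝ)} {V E : ℝ → ℝ → ℝ}

theorem IsClassicalSolution.hasDerivWithinAt_V (hs : IsClassicalSolution c V₀ E₀ U V E)
    (hU : IsOpen U) {y : ℝ → ℝ} {y' t : ℝ} (ht : 0 ≤ t) (hta : (t, y t) ∈ U)
    (hy : HasDerivWithinAt y y' (Ici 0) t) :
    HasDerivWithinAt (fun s => V s (y s))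
      (-E t (y t) + deriv (V t) (y t) * (y' - V t (y t))) (Ici 0) t := by
  refine (hasDerivWithinAt_curve hU hs.contDiffOn_V ht hta hy).congr_deriv ?_
  rw [fderivWithin_apply_one hU hs.contDiffOn_V ht hta]
  linear_combination hs.eq_V t (y t) ht hta

theorem IsClassicalSolution.hasDerivWithinAt_E (hs : IsClassicalSolution c V₀ E₀ U V E)
    (hU : IsOpen U) {y : ℝ → ℝ} {y' t : ℝ} (ht : 0 ≤ t) (hta : (t, y t) ∈ U)
    (hy : HasDerivWithinAt y y' (Ici 0) t) :
    HasDerivWithinAt (fun s => E s (y s))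
      (c (y t) * V t (y t) + deriv (E t) (y t) * (y' - V t (y t))) (Ici 0) t := by
  refine (hasDerivWithinAt_curve hU hs.contDiffOn_E ht hta hy).congr_deriv ?_
  rw [fderivWithin_apply_one hU hs.contDiffOn_E ht hta]
  linear_combination hs.eq_E t (y t) ht hta

/-- The characteristics of a classical solution are the solutions of the characteristic system
`x' = v`, `v' = -e`, `e' = c(x) v`. -/
theorem IsClassicalSolution.characteristic_eq (hs : IsClassicalSolution c V₀ E₀ U V E)
    (hU : IsOpen U) (hc : ContDiff ℝ 1 c) {x₀ T : ℝ} {x : ℝ → ℝ}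
    (hx : IsCharacteristic V U x₀ T x) {y v e : ℝ → ℝ} (hy : ∀ t, HasDerivAt y (v t) t)
    (hv : ∀ t, HasDerivAt v (-e t) t) (he : ∀ t, HasDerivAt e (c (y t) * v t) t)
    (hy0 : y 0 = x₀) (hv0 : v 0 = V₀ x₀) (he0 : e 0 = E₀ x₀) {t : ℝ} (ht : t ∈ Ico 0 T) :
    x t = y t := by
  have hsub : ∀ s ∈ Icc 0 t, s ∈ Ico 0 T := fun s hs => ⟨hs.1, hs.2.trans_lt ht.2⟩
  have hx' : ∀ s ∈ Icc 0 t, HasDerivWithinAt x (V s (x s)) (Ici 0) s := fun s hs =>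
    hx.deriv_eq s (hsub s hs)
  have hV' : ∀ s ∈ Icc 0 t, HasDerivWithinAt (fun s => V s (x s)) (-E s (x s)) (Ici 0) s :=
    fun s hss => by
      simpa using hs.hasDerivWithinAt_V hU hss.1 (hx.mem s (hsub s hss)) (hx' s hss)
  have hE' : ∀ s ∈ Icc 0 t, HasDerivWithinAt (fun s => E s (x s)) (c (x s) * V s (x s))
      (Ici 0) s := fun s hss => by
    simpa using hs.hasDerivWithinAt_E hU hss.1 (hx.mem s (hsub s hss)) (hx' s hss)
  have hxc : ContinuousOn x (Icc 0 t) := fun s hs =>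
    (hx' s hs).continuousWithinAt.mono Icc_subset_Ici_self
  have hyc : Continuous y := continuous_iff_continuousAt.2 fun s => (hy s).continuousAt
  have hvc : Continuous v := continuous_iff_continuousAt.2 fun s => (hv s).continuousAt
  obtain ⟨m₁, hm₁⟩ := (isCompact_Icc (a := 0) (b := t)).exists_bound_of_continuousOn hxc
  obtain ⟨m₂, hm₂⟩ := (isCompact_Icc (a := 0) (b := t)).exists_bound_of_continuousOn
    hyc.continuousOn
  obtain ⟨m₃, hm₃⟩ := (isCompact_Icc (a := 0) (b := t)).exists_bound_of_continuousOn
    hvc.continuousOn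
  set R := max m₁ m₂ with hR
  have hxR : ∀ s ∈ Icc 0 t, x s ∈ Icc (-R) R := fun s hs =>
    abs_le.1 ((hm₁ s hs).trans (le_max_left _ _))
  have hyR : ∀ s ∈ Icc 0 t, y s ∈ Icc (-R) R := fun s hs =>
    abs_le.1 ((hm₂ s hs).trans (le_max_right _ _))
  obtain ⟨m, hm⟩ := (isCompact_Icc (a := -R) (b := R)).exists_bound_of_continuousOn
    hc.continuous.continuousOn
  obtain ⟨l, hl⟩ := (isCompact_Icc (a := -R) (b := R)).exists_bound_of_continuousOn
    (hc.continuous_deriv le_rfl).continuousOn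
  have hclip : ∀ p ∈ Icc (-R) R, ∀ q ∈ Icc (-R) R, |c p - c q| ≤ l * |p - q| := fun p hp q hq =>
    (convex_Icc (-R) R).norm_image_sub_le_of_norm_deriv_le
      (fun s _ => (hc.differentiable one_ne_zero) s) hl hq hp
  have h0t : (0 : ℝ) ∈ Icc 0 t := ⟨le_rfl, ht.1⟩
  have hm0 : 0 ≤ m := (norm_nonneg _).trans (hm _ (hxR 0 h0t))
  have hl0 : 0 ≤ l := (norm_nonneg _).trans (hl _ (hxR 0 h0t))
  have hm₃0 : 0 ≤ m₃ := (norm_nonneg _).trans (hm₃ 0 h0t)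
  have hx0U : (0, x₀) ∈ U := by have := hx.mem 0 (hsub 0 h0t); rwa [hx.start] at this
  have hIci : ∀ s ∈ Ico 0 t, Ici s ⊆ Ici 0 := fun s hs => Ici_subset_Ici.2 hs.1
  -- Both triples solve the characteristic system, whose right-hand side is Lipschitz on the compact
  -- range: `m` bounds `c`, `l` bounds `c'` and `m₃` bounds `v`.
  have hw := eq_zero_of_abs_deriv_le_mul_abs_self_of_eq_zero_right
    (f := fun s => (x s - y s, V s (x s) - v s, E s (x s) - e s))
    (f' := fun s => (V s (x s) - v s, -E s (x s) - -e s, c (x s) * V s (x s) - c (y s) * v s))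
    (K := 1 + m + l * m₃) (a := 0) (b := t)
    (fun s hs => (((hx' s hs).sub (hy s).hasDerivWithinAt).prodMk
      (((hV' s hs).sub (hv s).hasDerivWithinAt).prodMk
        ((hE' s hs).sub (he s).hasDerivWithinAt))).continuousWithinAt.mono Icc_subset_Ici_self)
    (fun s hs => by
      have hs' := Ico_subset_Icc_self hs
      exact ((((hx' s hs').sub (hy s).hasDerivWithinAt).prodMk
        (((hV' s hs').sub (hv s).hasDerivWithinAt).prodMk
          ((hE' s hs').sub (he s).hasDerivWithinAt)))).mono (hIci s hs))
    (by simp [hx.start, hy0, hv0, he0, hs.initial_V x₀ hx0U, hs.initial_E x₀ hx0U])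
    (fun s hs => by
      have hs' := Ico_subset_Icc_self hs
      set w : ℝ × ℝ × ℝ := (x s - y s, V s (x s) - v s, E s (x s) - e s) with hw
      have n1 : |x s - y s| ≤ ‖w‖ := norm_fst_le w
      have n2 : |V s (x s) - v s| ≤ ‖w‖ := (norm_fst_le w.2).trans (norm_snd_le w)
      have n3 : |E s (x s) - e s| ≤ ‖w‖ := (norm_snd_le w.2).trans (norm_snd_le w)
      have n0 := norm_nonneg w
      have hle : ‖w‖ ≤ (1 + m + l * m₃) * ‖w‖ := by
        have := mul_nonneg (add_nonneg hm0 (mul_nonneg hl0 hm₃0)) n0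
        linarith
      refine norm_prod_le_iff.2 ⟨n2.trans hle, norm_prod_le_iff.2 ⟨?_, ?_⟩⟩
      · refine le_trans ?_ hle
        simp only [Real.norm_eq_abs]
        rw [show -E s (x s) - -e s = -(E s (x s) - e s) by ring, abs_neg]
        exact n3
      · simp only [Real.norm_eq_abs]
        rw [show c (x s) * V s (x s) - c (y s) * v s
          = c (x s) * (V s (x s) - v s) + (c (x s) - c (y s)) * v s by ring]
        refine (abs_add_le _ _).trans ?_
        rw [abs_mul, abs_mul]
        have e1 := mul_le_mul (hm _ (hxR s hs')) n2 (abs_nonneg _) hm0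
        have e2 := (hclip _ (hxR s hs') _ (hyR s hs')).trans (mul_le_mul_of_nonneg_left n1 hl0)
        have e3 := mul_le_mul e2 (hm₃ s hs') (abs_nonneg _) (mul_nonneg hl0 n0)
        simp only [Real.norm_eq_abs] at e1 e3
        linarith) t ⟨ht.1, le_rfl⟩
  have := congrArg Prod.fst hw
  simp only [Prod.fst_zero] at this
  linarith

/-- A classical solution takes along the solutions of the characteristic system the values that
this system prescribes. -/
theorem IsClassicalSolution.eq_along (hs : IsClassicalSolution c V₀ E₀ U V E) (hU : IsOpen U)
    (hc : Continuous c) {y v e : ℝ → ℝ} {T : ℝ} (hyU : ∀ s ∈ Icc 0 T, (s, y s) ∈ U)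
    (hy : ∀ s ∈ Icc 0 T, HasDerivAt y (v s) s) (hv : ∀ s ∈ Icc 0 T, HasDerivAt v (-e s) s)
    (he : ∀ s ∈ Icc 0 T, HasDerivAt e (c (y s) * v s) s) (hv0 : v 0 = V₀ (y 0))
    (he0 : e 0 = E₀ (y 0)) {t : ℝ} (ht : t ∈ Icc 0 T) : V t (y t) = v t ∧ E t (y t) = e t := by
  have hyc : ContinuousOn y (Icc 0 T) := fun s hs => (hy s hs).continuousAt.continuousWithinAt
  -- `y` is not known to be a characteristic of `V`. Nevertheless the differences solve a
  -- homogeneous linear system whose coefficients involve `V_x` and `E_x`, bounded on the compact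
  -- curve.
  have hV' : ∀ s ∈ Icc 0 T, HasDerivWithinAt (fun s => V s (y s) - v s)
      (-(E s (y s) - e s) - deriv (V s) (y s) * (V s (y s) - v s)) (Ici 0) s := fun s hss =>
    ((hs.hasDerivWithinAt_V hU hss.1 (hyU s hss) (hy s hss).hasDerivWithinAt).sub
      (hv s hss).hasDerivWithinAt).congr_deriv (by ring)
  have hE' : ∀ s ∈ Icc 0 T, HasDerivWithinAt (fun s => E s (y s) - e s)
      ((c (y s) - deriv (E s) (y s)) * (V s (y s) - v s)) (Ici 0) s := fun s hss =>
    ((hs.hasDerivWithinAt_E hU hss.1 (hyU s hss) (hy s hss).hasDerivWithinAt).sub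
      (he s hss).hasDerivWithinAt).congr_deriv (by ring)
  obtain ⟨m₁, hm₁⟩ := (isCompact_Icc (a := 0) (b := T)).exists_bound_of_continuousOn
    (continuousOn_deriv_space hU hs.contDiffOn_V hyc hyU)
  obtain ⟨m₂, hm₂⟩ := (isCompact_Icc (a := 0) (b := T)).exists_bound_of_continuousOn
    ((hc.comp_continuousOn hyc).sub (continuousOn_deriv_space hU hs.contDiffOn_E hyc hyU))
  have h0T : (0 : ℝ) ∈ Icc 0 T := ⟨le_rfl, ht.1.trans ht.2⟩
  have hm₁0 : 0 ≤ m₁ := (norm_nonneg _).trans (hm₁ 0 h0T)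
  have hm₂0 : 0 ≤ m₂ := (norm_nonneg _).trans (hm₂ 0 h0T)
  have hw := eq_zero_of_abs_deriv_le_mul_abs_self_of_eq_zero_right
    (f := fun s => (V s (y s) - v s, E s (y s) - e s))
    (f' := fun s => (-(E s (y s) - e s) - deriv (V s) (y s) * (V s (y s) - v s),
      (c (y s) - deriv (E s) (y s)) * (V s (y s) - v s)))
    (K := 1 + m₁ + m₂) (a := 0) (b := T)
    (fun s hs => ((hV' s hs).prodMk (hE' s hs)).continuousWithinAt.mono Icc_subset_Ici_self)
    (fun s hs => ((hV' s (Ico_subset_Icc_self hs)).prodMk (hE' s (Ico_subset_Icc_self hs))).mono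
      (Ici_subset_Ici.2 hs.1))
    (by simp [hv0, he0, hs.initial_V _ (hyU 0 h0T), hs.initial_E _ (hyU 0 h0T)])
    (fun s hs => by
      have hs' := Ico_subset_Icc_self hs
      set w : ℝ × ℝ := (V s (y s) - v s, E s (y s) - e s) with hw
      have n1 : |V s (y s) - v s| ≤ ‖w‖ := norm_fst_le w
      have n2 : |E s (y s) - e s| ≤ ‖w‖ := norm_snd_le w
      have n0 := norm_nonneg w
      have e1 := mul_le_mul (hm₁ s hs') n1 (abs_nonneg _) hm₁0
      have e2 := mul_le_mul (hm₂ s hs') n1 (abs_nonneg _) hm₂0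
      simp only [Real.norm_eq_abs, Function.comp_apply, Pi.sub_apply] at e1 e2
      have p1 := mul_nonneg hm₁0 n0
      have p2 := mul_nonneg hm₂0 n0
      refine norm_prod_le_iff.2 ⟨?_, ?_⟩
      · simp only [Real.norm_eq_abs]
        refine (abs_sub _ _).trans ?_
        rw [abs_neg, abs_mul]
        linarith
      · simp only [Real.norm_eq_abs]
        rw [abs_mul]
        linarith) t ht
  have h1 := congrArg Prod.fst hw
  have h2 := congrArg Prod.snd hw
  simp only [Prod.fst_zero, Prod.snd_zero] at h1 h2
  exact ⟨by linarith, by linarith⟩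

/-- The space derivatives of a classical solution along a characteristic, in terms of the Jacobian
of the flow. -/
theorem IsClassicalSolution.deriv_mul_jacobian (hs : IsClassicalSolution c V₀ E₀ U V E)
    (hU : IsOpen U) (hc : Continuous c) {γ Φ k k' V₀' : ℝ → ℝ} {X Y J P : ℝ → ℝ → ℝ}
    (hfl : IsFlow γ Φ k k' V₀ V₀' X Y J P) (hΦ : ∀ x, HasDerivAt Φ (γ x) x)
    (hk : ∀ a, k a = Φ a - E₀ a) {O : Set ℝ} (hO : IsOpen O) (hγ : ∀ x ∈ O, γ x = c x)
    (hk' : ∀ a, HasDerivAt k (k' a) a) {a t : ℝ} (ht : 0 ≤ t)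
    (hXU : ∀ s ∈ Icc 0 t, (s, X s a) ∈ U) (hXO : ∀ s ∈ Icc 0 t, X s a ∈ O) :
    deriv (V t) (X t a) * J t a = P t a ∧
      deriv (E t) (X t a) * J t a = γ (X t a) * J t a - k' a := by
  -- By compactness of `[0, t]`, neighbouring trajectories stay in `U` and `O` as well, so the
  -- values along them are known and can be differentiated in `b`. No positivity of `J` enters, so
  -- the resulting identities also hold where `J = 0`.
  have hev : ∀ᶠ b in 𝓝 a, ∀ s ∈ Icc 0 t, (s, X s b) ∈ U ∧ X s b ∈ O := by
    refine isCompact_Icc.eventually_forall_of_forall_eventually fun s hs => ?_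
    have hX : Continuous fun z : ℝ × ℝ => X z.2 z.1 := hfl.contX.comp continuous_swap
    exact ((continuous_snd.prodMk hX).continuousAt.eventually_mem
      (hU.mem_nhds (hXU s hs))).and (hX.continuousAt.eventually_mem (hO.mem_nhds (hXO s hs)))
  have heq : ∀ᶠ b in 𝓝 a, V t (X t b) = Y t b ∧ E t (X t b) = Φ (X t b) - k b := by
    filter_upwards [hev] with b hb
    refine hs.eq_along hU hc (y := fun s => X s b) (v := fun s => Y s b)
      (e := fun s => Φ (X s b) - k b) (fun s hs => (hb s hs).1) (fun s _ => hfl.dX s b)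
      (fun s _ => hfl.dV s b) (fun s hs => ?_) ?_ ?_ ⟨ht, le_rfl⟩
    · rw [← hγ _ (hb s hs).2]
      exact ((hΦ _).comp s (hfl.dX s b)).sub_const _
    · rw [hfl.V_zero, hfl.X_zero]
    · rw [hfl.X_zero, hk]; ring
  have hta := hXU t ⟨ht, le_rfl⟩
  have h1 := (hasDerivAt_space hU hs.contDiffOn_V ht hta).differentiableAt.hasDerivAt.comp a
    (hfl.daX t a)
  have h2 := (hasDerivAt_space hU hs.contDiffOn_E ht hta).differentiableAt.hasDerivAt.comp a
    (hfl.daX t a)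
  refine ⟨?_, ?_⟩
  · exact h1.unique ((hfl.daV t a).congr_of_eventuallyEq (heq.mono fun b hb => hb.1))
  · exact h2.unique ((((hΦ _).comp a (hfl.daX t a)).sub (hk' a)).congr_of_eventuallyEq
      (heq.mono fun b hb => hb.2))

/-! ### Classical solutions obtained by inverting the flow. -/

/-- An injective `C¹` map with invertible derivatives on an open set has an open image and a `C¹`
inverse. -/
theorem isOpen_image_and_contDiffAt_inverse {F G : Type*} [NormedAddCommGroup F] [NormedSpace ℝ F]
    [CompleteSpace F] [NormedAddCommGroup G] [NormedSpace ℝ G] [Nonempty F] {Ψ : F → G}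
    (hΨ : ContDiff ℝ 1 Ψ) {W : Set F} (hW : IsOpen W) (hinj : InjOn Ψ W)
    (hd : ∀ p ∈ W, ∃ L : F ≃L[ℝ] G, HasFDerivAt Ψ (L : F →L[ℝ] G) p) :
    IsOpen (Ψ '' W) ∧ ∀ q ∈ Ψ '' W, ContDiffAt ℝ 1 (Function.invFunOn Ψ W) q := by
  refine ⟨isOpen_iff_mem_nhds.2 ?_, ?_⟩
  · rintro _ ⟨p, hp, rfl⟩
    obtain ⟨L, hL⟩ := hd p hp
    rw [← (hΨ.contDiffAt.hasStrictFDerivAt' hL one_ne_zero).map_nhds_eq_of_equiv]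
    exact image_mem_map (hW.mem_nhds hp)
  · rintro _ ⟨p, hp, rfl⟩
    obtain ⟨L, hL⟩ := hd p hp
    have hst := hΨ.contDiffAt.hasStrictFDerivAt' hL one_ne_zero
    refine (hΨ.contDiffAt.to_localInverse hL one_ne_zero).congr_of_eventuallyEq ?_
    filter_upwards [hst.eventually_right_inverse,
      hst.localInverse_tendsto.eventually (hW.mem_nhds hp)] with q hq hqW
    have h1 : Function.invFunOn Ψ W q ∈ W := Function.invFunOn_mem ⟨_, hqW, hq⟩
    have h2 : Ψ (Function.invFunOn Ψ W q) = q := Function.invFunOn_eq ⟨_, hqW, hq⟩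
    exact hinj h1 hqW (h2.trans hq.symm)

/-- The shear `(s, b) ↦ (s, v s + j b)` of the plane for `j ≠ 0`. -/
theorem exists_shear (v : ℝ) {j : ℝ} (hj : j ≠ 0) : ∃ L : (ℝ × ℝ) ≃L[ℝ] (ℝ × ℝ),
    (L : ℝ × ℝ →L[ℝ] ℝ × ℝ) = (ContinuousLinearMap.fst ℝ ℝ ℝ).prod
      (v • ContinuousLinearMap.fst ℝ ℝ ℝ + j • ContinuousLinearMap.snd ℝ ℝ ℝ) := by
  refine ⟨ContinuousLinearEquiv.equivOfInverse
    ((ContinuousLinearMap.fst ℝ ℝ ℝ).prod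
      (v • ContinuousLinearMap.fst ℝ ℝ ℝ + j • ContinuousLinearMap.snd ℝ ℝ ℝ))
    ((ContinuousLinearMap.fst ℝ ℝ ℝ).prod
      (j⁻¹ • (ContinuousLinearMap.snd ℝ ℝ ℝ - v • ContinuousLinearMap.fst ℝ ℝ ℝ)))
    (fun p => ?_) (fun p => ?_), rfl⟩
  · ext
    · simp
    · simp [hj]
  · ext
    · simp
    · simp only [ContinuousLinearMap.prod_apply, ContinuousLinearMap.coe_fst', smul_apply,
        sub_apply, ContinuousLinearMap.coe_snd', smul_eq_mul, add_apply]
      field_simp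
      ring

/-- Along the flow lines of `X`, a function that is given in Lagrangian coordinates `(t, a)` has the
expected material derivative in Eulerian coordinates `(t, x)`. -/
theorem derivWithin_add_mul_deriv {F X Q : ℝ → ℝ → ℝ} {t a v f : ℝ} (ht : 0 ≤ t)
    (hQ : DifferentiableAt ℝ (Function.uncurry Q) (t, X t a))
    (hX : HasDerivAt (fun s => X s a) v t) (hF : HasDerivAt (fun s => F s a) f t)
    (heq : ∀ᶠ s in 𝓝 t, Q s (X s a) = F s a) :
    derivWithin (fun s => Q s (X t a)) (Ici 0) t + v * deriv (Q t) (X t a) = f := by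
  have hD := hQ.hasFDerivAt
  set D := fderiv ℝ (Function.uncurry Q) (t, X t a) with hDdef
  have h1 : HasDerivAt (fun s => Q s (X s a)) (D (1, v)) t :=
    hD.comp_hasDerivAt t (f := fun s => (s, X s a)) ((hasDerivAt_id t).prodMk hX)
  have h2 : HasDerivAt (fun s => Q s (X t a)) (D (1, 0)) t :=
    hD.comp_hasDerivAt t (f := fun s => (s, X t a)) ((hasDerivAt_id t).prodMk
      (hasDerivAt_const t _))
  have h3 : HasDerivAt (fun b => Q t b) (D (0, 1)) (X t a) :=
    hD.comp_hasDerivAt (X t a) (f := fun b => (t, b)) ((hasDerivAt_const _ t).prodMk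
      (hasDerivAt_id _))
  rw [h2.hasDerivWithinAt.derivWithin (uniqueDiffOn_Ici 0 t ht), h3.deriv,
    ← h1.unique (hF.congr_of_eventuallyEq heq),
    show ((1 : ℝ), v) = (1, 0) + v • ((0 : ℝ), (1 : ℝ)) by ext <;> simp, map_add, map_smul,
    smul_eq_mul]

/-- As long as the Jacobian of the flow is positive along a trajectory, there is a classical
solution near this trajectory. -/
theorem IsFlow.exists_classicalSolution {c γ Φ k k' V₀ V₀' E₀ : ℝ → ℝ} {X Y J P : ℝ → ℝ → ℝ}
    (hfl : IsFlow γ Φ k k' V₀ V₀' X Y J P) (hγc : Continuous γ) (hΦ : ∀ x, HasDerivAt Φ (γ x) x)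
    (hk : ∀ a, k a = Φ a - E₀ a) (hk' : ∀ a, HasDerivAt k (k' a) a) (hk'c : Continuous k')
    {O : Set ℝ} (hO : IsOpen O) (hγ : ∀ x ∈ O, γ x = c x) {x₀ T : ℝ}
    (hJ : ∀ t ∈ Ico 0 T, 0 < J t x₀) (hXO : ∀ t ∈ Ico 0 T, X t x₀ ∈ O) :
    ∃ (U : Set (ℝ × ℝ)) (V E : ℝ → ℝ → ℝ), IsOpen U ∧ IsClassicalSolution c V₀ E₀ U V E ∧
      IsCharacteristic V U x₀ T (fun t => X t x₀) := by
  have hΦc : Continuous Φ := continuous_iff_continuousAt.2 fun x => (hΦ x).continuousAt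
  have hkc : Continuous k := continuous_iff_continuousAt.2 fun x => (hk' x).continuousAt
  obtain ⟨hX1, hX2⟩ := contDiff_one_of_partials hfl.dX hfl.daX hfl.contV hfl.contJ
  obtain ⟨hY1, -⟩ := contDiff_one_of_partials hfl.dV hfl.daV
    ((hΦc.comp hfl.contX).sub (hkc.comp continuous_snd)).neg hfl.contP
  set H : ℝ → ℝ → ℝ := fun t a => Φ (X t a) - k a with hH
  have hHt : ∀ t a, HasDerivAt (fun s => H s a) (γ (X t a) * Y t a) t := fun t a =>
    ((hΦ _).comp t (hfl.dX t a)).sub_const _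
  obtain ⟨hH1, -⟩ := contDiff_one_of_partials (f := H)
    (f₁ := fun t a => γ (X t a) * Y t a) (f₂ := fun t a => γ (X t a) * J t a - k' a) hHt
    (fun t a => ((hΦ _).comp a (hfl.daX t a)).sub (hk' a))
    ((hγc.comp hfl.contX).mul hfl.contV)
    (((hγc.comp hfl.contX).mul hfl.contJ).sub (hk'c.comp continuous_snd))
  -- Requiring `J > 0` on the whole segment from `x₀` to `a` makes `X t` strictly increasing between
  -- any two points of a time slice of `W`; this turns local invertibility into injectivity.
  set W : Set (ℝ × ℝ) := {p | (∀ s ∈ Icc (0 : ℝ) 1, 0 < J p.1 (x₀ + s * (p.2 - x₀))) ∧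
    X p.1 p.2 ∈ O} with hW
  have hWo : IsOpen W := by
    have h1 : IsOpen {p : ℝ × ℝ | ∀ s ∈ Icc (0 : ℝ) 1, 0 < J p.1 (x₀ + s * (p.2 - x₀))} := by
      refine isOpen_iff_eventually.2 fun p hp => ?_
      refine isCompact_Icc.eventually_forall_of_forall_eventually fun s hs => ?_
      have hc : Continuous fun z : (ℝ × ℝ) × ℝ => J z.1.1 (x₀ + z.2 * (z.1.2 - x₀)) :=
        hfl.contJ.comp (f := fun z : (ℝ × ℝ) × ℝ => (z.1.1, x₀ + z.2 * (z.1.2 - x₀)))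
          (by fun_prop)
      exact hc.continuousAt.eventually_const_lt (hp s hs)
    exact h1.inter (hO.preimage hfl.contX)
  have hWJ : ∀ p ∈ W, ∀ b ∈ uIcc x₀ p.2, 0 < J p.1 b := fun p hp b hb => by
    rw [← segment_eq_uIcc, segment_eq_image'] at hb
    obtain ⟨s, hs, rfl⟩ := hb
    exact hp.1 s hs
  set Ψ : ℝ × ℝ → ℝ × ℝ := fun p => (p.1, X p.1 p.2) with hΨ
  have hΨ1 : ContDiff ℝ 1 Ψ := contDiff_fst.prodMk hX1
  have hlt : ∀ t a b, (t, a) ∈ W → (t, b) ∈ W → a < b → X t a < X t b := fun t a b ha hb hab => by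
    have hpos : ∀ s ∈ Icc a b, 0 < J t s := fun s hs => by
      rcases le_total s x₀ with h | h
      · exact hWJ _ ha s (by rw [mem_uIcc]; right; exact ⟨hs.1, h⟩)
      · exact hWJ _ hb s (by rw [mem_uIcc]; left; exact ⟨h, hs.2⟩)
    have hmono : StrictMonoOn (X t) (Icc a b) :=
      strictMonoOn_of_deriv_pos (convex_Icc a b)
        (fun s _ => (hfl.daX t s).continuousAt.continuousWithinAt)
        (fun s hs => by rw [(hfl.daX t s).deriv]; exact hpos s (interior_subset hs))
    exact hmono (left_mem_Icc.2 hab.le) (right_mem_Icc.2 hab.le) hab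
  have hinj : InjOn Ψ W := by
    rintro ⟨t, a⟩ ha ⟨t', b⟩ hb heq
    obtain ⟨rfl, h⟩ : t = t' ∧ X t a = X t' b := by simpa [hΨ] using heq
    rcases lt_trichotomy a b with hab | rfl | hab
    · exact absurd h (hlt _ _ _ ha hb hab).ne
    · rfl
    · exact absurd h (hlt _ _ _ hb ha hab).ne'
  have hd : ∀ p ∈ W, ∃ L : (ℝ × ℝ) ≃L[ℝ] (ℝ × ℝ), HasFDerivAt Ψ (L : ℝ × ℝ →L[ℝ] ℝ × ℝ) p := by
    rintro ⟨t, a⟩ hp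
    obtain ⟨L, hL⟩ := exists_shear (Y t a) (hWJ _ hp a right_mem_uIcc).ne'
    exact ⟨L, hL ▸ hasFDerivAt_fst.prodMk (hX2 t a)⟩
  obtain ⟨hUo, hg⟩ := isOpen_image_and_contDiffAt_inverse hΨ1 hWo hinj hd
  set g := Function.invFunOn Ψ W with hgdef
  have hgΨ : ∀ t a, (t, a) ∈ W → g (t, X t a) = (t, a) := fun t a h =>
    hinj.leftInvOn_invFunOn h
  have hU : ∀ t x, (t, x) ∈ Ψ '' W → ∃ a, (t, a) ∈ W ∧ X t a = x := by
    rintro t x ⟨⟨s, a⟩, hp, heq⟩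
    obtain ⟨rfl, h⟩ : s = t ∧ X s a = x := by simpa [hΨ] using heq
    exact ⟨a, hp, h⟩
  have hcurve : ∀ t ∈ Ico 0 T, (t, x₀) ∈ W := fun t ht =>
    ⟨fun s _ => by simpa using hJ t ht, hXO t ht⟩
  have hsec : ∀ t a, (t, a) ∈ W → ∀ᶠ s in 𝓝 t, (s, a) ∈ W := fun t a h =>
    (continuous_id.prodMk continuous_const).continuousAt.eventually_mem (hWo.mem_nhds h)
  have htr : ∀ Q : ℝ → ℝ → ℝ, ContDiff ℝ 1 (Function.uncurry Q) → ∀ q ∈ Ψ '' W,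
      ContDiffAt ℝ 1 (Function.uncurry fun t x => Q (g (t, x)).1 (g (t, x)).2) q :=
    fun Q hQ q hq => hQ.contDiffAt.comp q (hg q hq)
  refine ⟨Ψ '' W, fun t x => Y (g (t, x)).1 (g (t, x)).2, fun t x => H (g (t, x)).1 (g (t, x)).2,
    hUo, ⟨fun q hq => (htr Y hY1 q hq.1).contDiffWithinAt,
      fun q hq => (htr H hH1 q hq.1).contDiffWithinAt, fun t x ht hx => ?_, fun t x ht hx => ?_,
      fun x hx => ?_, fun x hx => ?_⟩, ⟨hfl.X_zero x₀, fun t ht => ⟨(t, x₀), hcurve t ht, rfl⟩,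
      fun t ht => ?_⟩⟩
  · obtain ⟨a, ha, rfl⟩ := hU t x hx
    have h := derivWithin_add_mul_deriv (F := Y) (X := X)
      (Q := fun t x => Y (g (t, x)).1 (g (t, x)).2) ht ((htr Y hY1 _ hx).differentiableAt
        one_ne_zero) (hfl.dX t a) (hfl.dV t a)
      ((hsec t a ha).mono fun s hs => by simp only [hgΨ s a hs])
    simp only [hgΨ t a ha]
    exact h
  · obtain ⟨a, ha, rfl⟩ := hU t x hx
    have h := derivWithin_add_mul_deriv (F := H) (X := X)
      (Q := fun t x => H (g (t, x)).1 (g (t, x)).2) ht ((htr H hH1 _ hx).differentiableAt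
        one_ne_zero) (hfl.dX t a) (hHt t a)
      ((hsec t a ha).mono fun s hs => by simp only [hgΨ s a hs])
    simp only [hgΨ t a ha]
    rw [h, hγ _ ha.2]
  · obtain ⟨a, ha, rfl⟩ := hU 0 x hx
    simp only [hgΨ 0 a ha]
    rw [hfl.V_zero, hfl.X_zero]
  · obtain ⟨a, ha, rfl⟩ := hU 0 x hx
    simp only [hgΨ 0 a ha]
    simp only [hH, hfl.X_zero, hk]
    ring
  · simp only [hgΨ t x₀ (hcurve t ht)]
    exact (hfl.dX t x₀).hasDerivWithinAt

/-! ### First zero of the Jacobian and truncation of the doping profile. -/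

/-- For an unforced oscillator `J'' = -γ J` the first zero of `J` is simple. -/
theorem velocity_ne_zero_of_first_zero {γ J P : ℝ → ℝ} {T : ℝ} (hT : 0 ≤ T) (hγ : ∀ t, 0 ≤ γ t)
    (hJ : ∀ t, HasDerivAt J (P t) t) (hP : ∀ t, HasDerivAt P (-(γ t * J t)) t)
    (hpos : ∀ t ∈ Icc 0 T, 0 ≤ J t) (h0 : 0 < J 0) (hJT : J T = 0) : P T ≠ 0 := by
  intro hPT
  -- `J` is concave up to `T`, so `P T = 0` would make it nondecreasing there, against `J T = 0 < J
  -- 0`.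
  have hanti : AntitoneOn P (Icc 0 T) := antitoneOn_of_deriv_nonpos (convex_Icc 0 T)
    (fun s _ => (hP s).continuousAt.continuousWithinAt)
    (fun s _ => (hP s).differentiableAt.differentiableWithinAt)
    (fun s hs => by
      rw [(hP s).deriv]
      have := mul_nonneg (hγ s) (hpos s (interior_subset hs))
      linarith)
  have hmono : MonotoneOn J (Icc 0 T) := monotoneOn_of_deriv_nonneg (convex_Icc 0 T)
    (fun s _ => (hJ s).continuousAt.continuousWithinAt)
    (fun s _ => (hJ s).differentiableAt.differentiableWithinAt)
    (fun s hs => by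
      rw [(hJ s).deriv, ← hPT]
      have hs' := interior_subset hs
      exact hanti hs' ⟨hT, le_rfl⟩ hs'.2)
  have := hmono ⟨le_rfl, hT⟩ ⟨hT, le_rfl⟩ hT
  linarith

/-- A continuous function that is positive at `0` and takes a nonpositive value later has a first
zero. -/
theorem exists_first_zero {J : ℝ → ℝ} (hJ : Continuous J) (h0 : 0 < J 0)
    (h : ∃ t, 0 ≤ t ∧ J t ≤ 0) : ∃ T > 0, J T = 0 ∧ ∀ t ∈ Ico 0 T, 0 < J t := by
  set S : Set ℝ := {t | 0 ≤ t ∧ J t ≤ 0} with hS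
  have hcl : IsClosed S :=
    (isClosed_le continuous_const continuous_id).inter (isClosed_le hJ continuous_const)
  have hbdd : BddBelow S := ⟨0, fun t ht => ht.1⟩
  have hmem : sInf S ∈ S := hcl.csInf_mem h hbdd
  have hlt : ∀ t ∈ Ico 0 (sInf S), 0 < J t := fun t ht => by
    by_contra! hle
    exact absurd (csInf_le hbdd ⟨ht.1, hle⟩) (not_le.2 ht.2)
  have hpos : 0 < sInf S := by
    refine lt_of_le_of_ne hmem.1 fun h => ?_
    have := hmem.2
    rw [← h] at this
    linarith
  refine ⟨sInf S, hpos, le_antisymm hmem.2 ?_, hlt⟩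
  have hcw : Tendsto J (𝓝[<] sInf S) (𝓝 (J (sInf S))) :=
    hJ.continuousAt.mono_left nhdsWithin_le_nhds
  refine ge_of_tendsto hcw ?_
  filter_upwards [Ioo_mem_nhdsLT hpos] with t ht
  exact (hlt t ⟨ht.1.le, ht.2⟩).le

/-- Near a point where the derivative does not vanish, a positive `C²` function agrees with a
bounded Lipschitz function on the line that is bounded away from zero. -/
theorem exists_truncation {c : ℝ → ℝ} (hc : ContDiff ℝ 2 c) (hc_pos : ∀ x, 0 < c x) {x₀ : ℝ}
    (hx₀ : deriv c x₀ ≠ 0) : ∃ (r c₀ c₁ b₀ b₁ σ : ℝ) (L : NNReal) (γ : ℝ → ℝ), 0 < r ∧ 0 < c₀ ∧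
      0 < b₀ ∧ (σ = 1 ∨ σ = -1) ∧ LipschitzWith L γ ∧ (∀ x, c₀ ≤ γ x) ∧ (∀ x, γ x ≤ c₁) ∧
      ∀ x ∈ Ioo (x₀ - r) (x₀ + r), γ x = c x ∧ b₀ ≤ σ * deriv c x ∧ σ * deriv c x ≤ b₁ := by
  have hc' : Continuous (deriv c) := hc.continuous_deriv one_le_two
  obtain ⟨σ, hσ, hσpos⟩ : ∃ σ : ℝ, (σ = 1 ∨ σ = -1) ∧ 0 < σ * deriv c x₀ := by
    rcases lt_or_gt_of_ne hx₀ with h | h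
    · exact ⟨-1, Or.inr rfl, by linarith⟩
    · exact ⟨1, Or.inl rfl, by linarith⟩
  obtain ⟨ρ, hρ, hball⟩ := Metric.eventually_nhds_iff.1
    ((continuous_const.mul hc').continuousAt.eventually_const_lt
      (show σ * deriv c x₀ / 2 < σ * deriv c x₀ by linarith))
  set r := ρ / 2 with hr
  have hr0 : 0 < r := by positivity
  have hle : x₀ - r ≤ x₀ + r := by linarith
  have hne : (Icc (x₀ - r) (x₀ + r)).Nonempty := nonempty_Icc.2 hle
  obtain ⟨p, -, hp⟩ := (isCompact_Icc (a := x₀ - r) (b := x₀ + r)).exists_isMinOn hne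
    hc.continuous.continuousOn
  obtain ⟨q, -, hq⟩ := (isCompact_Icc (a := x₀ - r) (b := x₀ + r)).exists_isMaxOn hne
    hc.continuous.continuousOn
  obtain ⟨m, hm⟩ := (isCompact_Icc (a := x₀ - r) (b := x₀ + r)).exists_bound_of_continuousOn
    hc'.continuousOn
  have hm0 : 0 ≤ m := (norm_nonneg _).trans (hm x₀ ⟨by linarith, by linarith⟩)
  obtain ⟨L, hL⟩ : ∃ L : NNReal, (L : ℝ) = m := ⟨⟨m, hm0⟩, rfl⟩
  have hproj : LipschitzWith 1 (fun s : ℝ => (projIcc (x₀ - r) (x₀ + r) hle s : ℝ)) :=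
    LipschitzWith.projIcc hle
  -- The argument of `c` is clamped to the closed interval: this keeps the Lipschitz constant and
  -- the extrema, and agrees with `c` on the open interval, where `γ` is therefore differentiable.
  refine ⟨r, c p, c q, σ * deriv c x₀ / 2, m, σ, L, fun x => c (projIcc (x₀ - r) (x₀ + r) hle x),
    hr0, hc_pos p, by linarith, hσ, LipschitzWith.of_dist_le_mul fun x y => ?_,
    fun x => hp (projIcc _ _ hle x).2, fun x => hq (projIcc _ _ hle x).2,
    fun x hx => ⟨?_, ?_, ?_⟩⟩
  · have h1 := (convex_Icc (x₀ - r) (x₀ + r)).norm_image_sub_le_of_norm_deriv_le (f := c)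
      (fun s _ => (hc.differentiable two_ne_zero) s) hm (projIcc _ _ hle y).2 (projIcc _ _ hle x).2
    have h2 := hproj.dist_le_mul x y
    rw [NNReal.coe_one, one_mul, dist_eq_norm] at h2
    rw [dist_eq_norm, hL]
    exact h1.trans (mul_le_mul_of_nonneg_left h2 hm0)
  · simp only [projIcc_of_mem hle (Ioo_subset_Icc_self hx)]
  · refine (hball ?_).le
    rw [Real.dist_eq, abs_lt]
    exact ⟨by linarith [hx.1], by linarith [hx.2]⟩
  · have hσa : |σ| = 1 := by rcases hσ with rfl | rfl <;> norm_num
    refine (le_abs_self _).trans ?_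
    rw [abs_mul, hσa, one_mul]
    exact hm x (Ioo_subset_Icc_self hx)

end EulerPoisson

/-! ### Blow-up of small perturbations. -/

theorem mainTheorem4 (c : ℝ → ℝ) (hc : ContDiff ℝ 2 c) (hc_pos : ∀ x, 0 < c x)
    (hc_nonconst : ∃ x y, c x ≠ c y) :
    (∃ x₀, deriv c x₀ ≠ 0) ∧
    ∀ x₀, deriv c x₀ ≠ 0 → ∃ ε > 0, ∀ V₀ E₀ : ℝ → ℝ, ContDiff ℝ 2 V₀ → ContDiff ℝ 2 E₀ →
      (V₀ x₀, E₀ x₀) ≠ (0, 0) → ‖(V₀ x₀, E₀ x₀)‖ < ε →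
      ∃ T > 0, EulerPoisson.BlowsUpAlongCharacteristicAt c V₀ E₀ x₀ T ∧
        ∀ (T' : ℝ) (V E : ℝ → ℝ → ℝ),
          EulerPoisson.IsClassicalSolution c V₀ E₀ (Iio T' ×ˢ univ) V E → T' ≤ T := by
  have hcd : Differentiable ℝ c := hc.differentiable two_ne_zero
  refine ⟨?_, fun x₀ hx₀ => ?_⟩
  · by_contra! h
    obtain ⟨x, y, hxy⟩ := hc_nonconst
    exact hxy (is_const_of_deriv_eq_zero hcd h x y)
  obtain ⟨r, c₀, c₁, b₀, b₁, σ, L, γ, hr, hc₀, hb₀, hσ, hL, hγ₀, hγ₁, hγc⟩ :=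
    EulerPoisson.exists_truncation hc hc_pos hx₀
  have hc₁ : 0 < c₁ := hc₀.trans_le ((hγ₀ 0).trans (hγ₁ 0))
  have hγcont : Continuous γ := hL.continuous
  set Λ := 4 / c₀ * (1 + c₁ / c₀ ^ 2) with hΛ
  have hΛ0 : 0 < Λ := by positivity
  -- The energy estimate gives `(X - x₀)² ≤ 2Λ n²` for data of norm `n`, and `2Λ ≤ (1 + 2Λ)²`; so
  -- the trajectory never leaves the interval where `γ = c`.
  refine ⟨r / (1 + 2 * Λ), by positivity, fun V₀ E₀ hV₀ hE₀ hne hsmall => ?_⟩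
  set Φ : ℝ → ℝ := fun x => ∫ s in x₀..x, γ s with hΦdef
  have hΦ : ∀ x, HasDerivAt Φ (γ x) x := fun x =>
    (hγcont.integral_hasStrictDerivAt x₀ x).hasDerivAt
  set k : ℝ → ℝ := fun a => Φ a - E₀ a with hk
  set k' : ℝ → ℝ := fun a => γ a - deriv E₀ a with hk'
  have hkd : ∀ a, HasDerivAt k (k' a) a := fun a =>
    (hΦ a).sub ((hE₀.differentiable two_ne_zero) a).hasDerivAt
  have hk'c : Continuous k' := hγcont.sub (hE₀.continuous_deriv one_le_two)
  obtain ⟨X, Y, J, P, hfl⟩ := EulerPoisson.exists_isFlow (γ := γ) (Φ := Φ) (k := k) (k' := k')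
    (V₀ := V₀) (V₀' := deriv V₀) (C := c₁) hL
    (fun x => by rw [abs_of_pos (hc₀.trans_le (hγ₀ x))]; exact hγ₁ x) hΦ hkd hk'c
    (fun a => ((hV₀.differentiable two_ne_zero) a).hasDerivAt) (hV₀.continuous_deriv one_le_two)
  have hEk : Φ x₀ - k x₀ = E₀ x₀ := by simp only [hk]; ring
  have hXO : ∀ t, X t x₀ ∈ Ioo (x₀ - r) (x₀ + r) := fun t => by
    have h1 := (EulerPoisson.oscillator_bounds hc₀ hγ₀ hγ₁ hΦ (fun t => hfl.dX t x₀)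
      (fun t => hfl.dV t x₀)).1 t
    rw [hfl.X_zero, hfl.V_zero, hEk] at h1
    set n := ‖(V₀ x₀, E₀ x₀)‖ with hn
    have hVn : V₀ x₀ ^ 2 ≤ n ^ 2 := by
      rw [← sq_abs]; exact pow_le_pow_left₀ (abs_nonneg _) (norm_fst_le (V₀ x₀, E₀ x₀)) 2
    have hEn : E₀ x₀ ^ 2 ≤ n ^ 2 := by
      rw [← sq_abs]; exact pow_le_pow_left₀ (abs_nonneg _) (norm_snd_le (V₀ x₀, E₀ x₀)) 2
    have hnr : n * (1 + 2 * Λ) < r := (lt_div_iff₀ (by positivity)).1 hsmall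
    have hn0 : 0 ≤ n := norm_nonneg _
    have h2 : (X t x₀ - x₀) ^ 2 < r ^ 2 := by
      have h3 : (n * (1 + 2 * Λ)) ^ 2 < r ^ 2 := pow_lt_pow_left₀ hnr (by positivity) two_ne_zero
      have h4 : Λ * (V₀ x₀ ^ 2 + E₀ x₀ ^ 2) ≤ Λ * (n ^ 2 + n ^ 2) :=
        mul_le_mul_of_nonneg_left (add_le_add hVn hEn) hΛ0.le
      nlinarith [sq_nonneg n, mul_nonneg (sq_nonneg n) hΛ0.le, sq_nonneg (n * Λ)]
    have h5 := abs_lt.1 (abs_lt_of_sq_lt_sq h2 hr.le)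
    exact ⟨by linarith [h5.1], by linarith [h5.2]⟩
  obtain ⟨T, hT, hJT, hJpos⟩ := EulerPoisson.exists_first_zero (J := fun t => J t x₀)
    (continuous_iff_continuousAt.2 fun t => (hfl.dJ t x₀).continuousAt) (by simp [hfl.J_zero])
    (hfl.exists_jacobian_nonpos (b := deriv c) (a := x₀) hc₀ hγ₀ hγ₁ hΦ (by rwa [hEk]) hσ hb₀
      (fun t => ((hcd _).hasDerivAt).congr_of_eventuallyEq
        (eventually_of_mem (isOpen_Ioo.mem_nhds (hXO t)) fun x hx => (hγc x hx).1))
      (fun t => (hγc _ (hXO t)).2.1) (fun t => (hγc _ (hXO t)).2.2))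
  -- The numerator of `|V_x| + |E_x| = (|P| + |γJ - κ|) / J` must not vanish with `J`. For `κ ≠ 0`
  -- this is immediate; for `κ = 0` the first zero of `J` is simple.
  have hnondeg : 0 < |P T x₀| + |k' x₀| := by
    rcases eq_or_ne (k' x₀) 0 with h | h
    · have hP : P T x₀ ≠ 0 := EulerPoisson.velocity_ne_zero_of_first_zero
        (γ := fun t => γ (X t x₀)) (J := fun t => J t x₀) (P := fun t => P t x₀) hT.le
        (fun t => hc₀.le.trans (hγ₀ _)) (fun t => hfl.dJ t x₀)
        (fun t => (hfl.dP t x₀).congr_deriv (by rw [h]; ring))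
        (fun t ht => by
          rcases ht.2.eq_or_lt with rfl | hlt
          · exact hJT.ge
          · exact (hJpos t ⟨ht.1, hlt⟩).le)
        (by simp [hfl.J_zero]) hJT
      have := abs_pos.2 hP
      have := abs_nonneg (k' x₀)
      linarith
    · have := abs_pos.2 h
      have := abs_nonneg (P T x₀)
      linarith
  have hγO : ∀ x ∈ Ioo (x₀ - r) (x₀ + r), γ x = c x := fun x hx => (hγc x hx).1
  refine ⟨T, hT, ⟨?_, fun U V E x hU hs hx => ?_⟩, fun T' V E hs => ?_⟩
  · obtain ⟨U, V, E, hU, hs, hx⟩ := hfl.exists_classicalSolution hγcont hΦ (fun a => rfl) hkd hk'c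
      isOpen_Ioo hγO hJpos (fun t _ => hXO t)
    exact ⟨U, V, E, _, hU, hs, hx⟩
  · have hxX : ∀ t ∈ Ico 0 T, x t = X t x₀ := fun t ht =>
      hs.characteristic_eq hU (hc.of_le one_le_two) hx (y := fun t => X t x₀)
        (v := fun t => Y t x₀) (e := fun t => Φ (X t x₀) - k x₀) (fun t => hfl.dX t x₀)
        (fun t => hfl.dV t x₀) (fun t => by
          rw [← hγO _ (hXO t)]
          exact ((hΦ _).comp t (hfl.dX t x₀)).sub_const _)
        (hfl.X_zero x₀) (hfl.V_zero x₀) (by rw [hfl.X_zero, hEk]) ht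
    have hderiv : ∀ t ∈ Ico 0 T, (|P t x₀| + |γ (X t x₀) * J t x₀ - k' x₀|) * (J t x₀)⁻¹
        = |deriv (V t) (x t)| + |deriv (E t) (x t)| := fun t ht => by
      obtain ⟨h1, h2⟩ := hs.deriv_mul_jacobian hU hc.continuous hfl hΦ (fun a => rfl) isOpen_Ioo
        hγO hkd ht.1 (fun s hs' => by
          have hsT : s ∈ Ico 0 T := ⟨hs'.1, hs'.2.trans_lt ht.2⟩
          rw [← hxX s hsT]
          exact hx.mem s hsT) (fun s _ => hXO s)
      have hJt := hJpos t ht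
      rw [← h1, ← h2, hxX t ht, abs_mul, abs_mul, abs_of_pos hJt, ← add_mul, mul_assoc,
        mul_inv_cancel₀ hJt.ne', mul_one]
    have hJc : Continuous fun t => J t x₀ :=
      continuous_iff_continuousAt.2 fun t => (hfl.dJ t x₀).continuousAt
    have hPc : Continuous fun t => P t x₀ :=
      continuous_iff_continuousAt.2 fun t => (hfl.dP t x₀).continuousAt
    have hXc : Continuous fun t => X t x₀ :=
      continuous_iff_continuousAt.2 fun t => (hfl.dX t x₀).continuousAt
    have hnum : Tendsto (fun t => |P t x₀| + |γ (X t x₀) * J t x₀ - k' x₀|) (𝓝[<] T)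
        (𝓝 (|P T x₀| + |k' x₀|)) := by
      have h1 : Continuous fun t => |P t x₀| + |γ (X t x₀) * J t x₀ - k' x₀| := by fun_prop
      have h2 := (h1.tendsto T).mono_left (nhdsWithin_le_nhds (s := Iio T))
      have hJT' : J T x₀ = 0 := hJT
      simpa [hJT'] using h2
    have hev : ∀ᶠ t in 𝓝[<] T, t ∈ Ico 0 T :=
      mem_of_superset (Ioo_mem_nhdsLT hT) Ioo_subset_Ico_self
    have hden : Tendsto (fun t => (J t x₀)⁻¹) (𝓝[<] T) atTop := by
      refine tendsto_inv_nhdsGT_zero.comp (tendsto_nhdsWithin_iff.2 ⟨?_, ?_⟩)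
      · have h2 := (hJc.tendsto T).mono_left (nhdsWithin_le_nhds (s := Iio T))
        rwa [hJT] at h2
      · exact hev.mono fun t ht => hJpos t ht
    exact (hnum.pos_mul_atTop hnondeg hden).congr' (hev.mono hderiv)
  -- A solution reaching beyond `T` has finite derivatives at time `T`; the Jacobian identities with
  -- `J = 0` then give `P = 0` and `κ = 0`.
  · by_contra! hlt
    obtain ⟨h1, h2⟩ := hs.deriv_mul_jacobian (isOpen_Iio.prod isOpen_univ) hc.continuous hfl hΦ
      (fun a => rfl) isOpen_Ioo hγO hkd hT.le (fun s hs' => ⟨hs'.2.trans_lt hlt, mem_univ _⟩)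
      (fun s _ => hXO s)
    have hJT' : J T x₀ = 0 := hJT
    rw [hJT', mul_zero] at h1 h2
    rw [mul_zero, zero_sub, eq_comm, neg_eq_zero] at h2
    rw [← h1, h2] at hnondeg
    simp at hnondeg
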